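/- Let $d\ge 1$, and let $\tau,\varpi,r>0$ and $\delta>0$. Let $X\in\mathbb{R}^d$ be a random vector with mean $0$ that is $\tau^2$-sub-Gaussian, i.e. $\mathbb{E}\,e^{\langle u,X\rangle}\le e^{\tau^2\|u\|_2^2/2}$ for all $u\in\mathbb{R}^d$, and suppose that $\mathbb{E}[XX^T]\succeq\varpi\tau^2 I_d$. Let $\theta^{opt}\in\mathbb{R}^d$ with $\|\theta^{opt}\|_2\le r/2$. Let $(x_1,y_1),\dots,(x_M,y_M)$ be i.i.d., where $x_i$ is distributed as $X$ and, conditionally on $x_i$, the label $y_i\in\{1,-1\}$ satisfies $\mathbb{P}(y_i=\pm1\mid x_i)=\frac{e^{\pm\langle\theta^{opt},x_i\rangle}}{1+e^{\pm\langle\theta^{opt},x_i\rangle}}$. For $\lambda\ge 0$ put $$f_M(\theta;i)=\log\big(1+e^{-\langle\theta,x_i\rangle y_i}\big)+\lambda\sum_{j=1}^d\frac{\theta(j)^2}{1+\theta(j)^2},\qquad F_M(\theta)=\frac1M\sum_{i=1}^M f_M(\theta;i),$$ and let $L(\theta)=\mathbb{E}\log\big(1+e^{-\langle\theta,X\rangle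 Y}\big)$, where $(X,Y)$ is distributed as $(x_1,y_1)$. Let $B=\{\theta\in\mathbb{R}^d:\|\theta\|_2\le r\}$ and let $\Pi_B$ be the Euclidean projection onto $B$. There are a constant $c>0$ depending only on $(\tau^2,\varpi,r)$ and a constant $\bar C>0$ depending only on $(\tau^2,\varpi,r,\delta)$ such that, whenever $0\le\lambda\le c/\sqrt d$, $M\ge2$ and $M\ge\bar C\,d\log M$, the following two events occur simultaneously with probability at least $1-\delta$. 1. Within $B$, $F_M$ has the same landscape as $L$: just as $L$ has $\theta^{opt}$ as its only stationary point in $B$ and as its unique minimizer over $B$, $F_M$ has exactly one stationary point $\theta_M^{opt}$ in $B$, and $\theta_M^{opt}$ is the unique minimizer of $F_M$ over $B$. 2. Conditionally on the data $\{(x_i,y_i)\}_{1\le i\le M}$, for every initial point $\theta_0^p\in\mathbb{R}^d$ and all nonnegative stepsizes $(\gamma_n)_{n\ge1}$ with $\sum_n\gamma_n=\infty$ and $\sum_n\gamma_n^2<\infty$, the projected stochastic gradient descent $$\theta_{n+1}^p=\Pi_B\big(\theta_n^p-\gamma_{n+1}\nabla f_M(\theta_n^p;i_{n+1})\big),$$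 with $i_1,i_2,\dots$ independent and uniformly distributed on $\{1,\dots,M\}$, converges almost surely to $\theta_M^{opt}$. -/

import Mathlib

open MeasureTheory ProbabilityTheory Filter Topology

noncomputable section

namespace LogisticLandscape

/-- `d`-dimensional Euclidean space. -/
abbrev E (d : ℕ) : Type := EuclideanSpace ℝ (Fin d)

/-! ### The statistical model -/

/-- A random vector with law `μ` is `τ²`-sub-Gaussian:
`𝔼 exp ⟨u, X - 𝔼 X⟩ ≤ exp (τ² ‖u‖² / 2)` for every `u` (in particular the left side is finite). -/
def IsSubGaussianLaw {d : ℕ} (μ : Measure (E d)) (τ : ℝ) : Prop :=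
  ∀ u : E d,
    Integrable (fun x : E d => Real.exp (inner ℝ u (x - ∫ z, z ∂μ))) μ ∧
    ∫ x, Real.exp (inner ℝ u (x - ∫ z, z ∂μ)) ∂μ ≤ Real.exp (τ ^ 2 * ‖u‖ ^ 2 / 2)

/-- `𝔼 [X Xᵀ] ⪰ κ I` for a random vector with law `μ`. -/
def SecondMomentGE {d : ℕ} (μ : Measure (E d)) (κ : ℝ) : Prop :=
  ∀ u : E d, κ * ‖u‖ ^ 2 ≤ ∫ x, (inner ℝ u x) ^ 2 ∂μ

/-- The logistic probability `e^{s ⟨θ, x⟩} / (1 + e^{s ⟨θ, x⟩})` of the label `s ∈ {1, -1}`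
at the covariate `x`. -/
def labelProb {d : ℕ} (θ x : E d) (s : ℝ) : ℝ :=
  Real.exp (s * inner ℝ θ x) / (1 + Real.exp (s * inner ℝ θ x))

lemma labelProb_nonneg {d : ℕ} (θ x : E d) (s : ℝ) : 0 ≤ labelProb θ x s := by
  unfold labelProb; positivity

lemma labelProb_add {d : ℕ} (θ x : E d) : labelProb θ x 1 + labelProb θ x (-1) = 1 := by
  unfold labelProb
  have h := Real.exp_pos (inner ℝ θ x)
  rw [one_mul, neg_one_mul, Real.exp_neg]
  field_simp
  ring

lemma measurable_labelProb {d : ℕ} (θ : E d) (s : ℝ) :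
    Measurable (fun x : E d => labelProb θ x s) := by
  unfold labelProb; fun_prop

/-- The conditional law of the label given the covariate: given `x`, the label is `1` with
probability `e^{⟨θ, x⟩} / (1 + e^{⟨θ, x⟩})` and `-1` with probability
`e^{-⟨θ, x⟩} / (1 + e^{-⟨θ, x⟩})`. -/
def labelKernel {d : ℕ} (θ : E d) : Kernel (E d) ℝ where
  toFun x := ENNReal.ofReal (labelProb θ x 1) • Measure.dirac (1 : ℝ)
    + ENNReal.ofReal (labelProb θ x (-1)) • Measure.dirac (-1 : ℝ)
  measurable' := by
    refine Measure.measurable_of_measurable_coe _ fun s _ => ?_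
    simp only [Measure.coe_add, Measure.coe_smul, Pi.add_apply, Pi.smul_apply, smul_eq_mul]
    exact ((measurable_labelProb θ 1).ennreal_ofReal.mul_const _).add
      ((measurable_labelProb θ (-1)).ennreal_ofReal.mul_const _)

instance {d : ℕ} (θ : E d) : IsMarkovKernel (labelKernel θ) where
  isProbabilityMeasure x := ⟨by
    change (ENNReal.ofReal (labelProb θ x 1) • Measure.dirac (1 : ℝ)
      + ENNReal.ofReal (labelProb θ x (-1)) • Measure.dirac (-1 : ℝ)) Set.univ = 1
    simp only [Measure.coe_add, Measure.coe_smul, Pi.add_apply, Pi.smul_apply, smul_eq_mul,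
      measure_univ, mul_one]
    rw [← ENNReal.ofReal_add (labelProb_nonneg _ _ _) (labelProb_nonneg _ _ _), labelProb_add,
      ENNReal.ofReal_one]⟩

/-- The joint law of one observation `(X, Y)`: `X` has law `μ`, and given `X` the label `Y`
follows the logistic model with parameter `θ`. -/
def dataLaw {d : ℕ} (μ : Measure (E d)) (θ : E d) : Measure (E d × ℝ) :=
  μ ⊗ₘ labelKernel θ

/-! ### Objective functions -/

/-- The logistic loss `log (1 + e^{-(θᵀ x) y})`. -/
def logisticLoss {d : ℕ} (θ x : E d) (y : ℝ) : ℝ :=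
  Real.log (1 + Real.exp (-(inner ℝ θ x) * y))

/-- The nonconvex regularizer `∑ⱼ θ(j)² / (1 + θ(j)²)`. -/
def regularizer {d : ℕ} (θ : E d) : ℝ :=
  ∑ j, (θ j) ^ 2 / (1 + (θ j) ^ 2)

/-- The population risk `L(θ) = 𝔼 log (1 + e^{-(θᵀ X) Y})`. -/
def populationRisk {d : ℕ} (μ : Measure (E d)) (θopt θ : E d) : ℝ :=
  ∫ z, logisticLoss θ z.1 z.2 ∂(dataLaw μ θopt)

/-- The objective `f_M(θ; i)` attached to the single observation `i`. -/
def sampleObjective {d M : ℕ} (x : Fin M → E d) (y : Fin M → ℝ) (lam : ℝ) (i : Fin M)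
    (θ : E d) : ℝ :=
  logisticLoss θ (x i) (y i) + lam * regularizer θ

/-- The empirical objective `F_M(θ)`. -/
def empiricalObjective {d M : ℕ} (x : Fin M → E d) (y : Fin M → ℝ) (lam : ℝ) (θ : E d) : ℝ :=
  (1 / (M : ℝ)) * ∑ i, logisticLoss θ (x i) (y i) + lam * regularizer θ

/-! ### Landscape -/

/-- `θ` is a stationary point of `F`: `F` is differentiable at `θ` with zero gradient. -/
def IsStationaryPoint {d : ℕ} (F : E d → ℝ) (θ : E d) : Prop :=
  HasGradientAt F 0 θ

/-- Within `S`, the function `F` has exactly one stationary point, namely `θ`, and `θ` is also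
the unique minimizer of `F` over `S`. -/
structure IsUniqueStationaryMinimizer {d : ℕ} (F : E d → ℝ) (S : Set (E d)) (θ : E d) : Prop where
  mem : θ ∈ S
  stationary : IsStationaryPoint F θ
  unique_stationary : ∀ θ' ∈ S, IsStationaryPoint F θ' → θ' = θ
  unique_min : ∀ θ' ∈ S, θ' ≠ θ → F θ < F θ'

/-! ### Projected stochastic gradient descent -/

/-- The `L₂`-projection of `v` onto the closed ball of radius `r` about the origin. -/
def projBall {d : ℕ} (r : ℝ) (v : E d) : E d :=
  if ‖v‖ ≤ r then v else (r / ‖v‖) • v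

/-- `projBall r v` is the nearest point to `v` in the closed ball of radius `r`. -/
theorem projBall_spec {d : ℕ} {r : ℝ} (hr : 0 ≤ r) (v : E d) :
    projBall r v ∈ Metric.closedBall (0 : E d) r ∧
    ∀ w ∈ Metric.closedBall (0 : E d) r, ‖v - projBall r v‖ ≤ ‖v - w‖ := by
  unfold projBall
  split_ifs with h
  · exact ⟨by simpa using h, fun w _ => by simp⟩
  · push Not at h
    have hv : 0 < ‖v‖ := lt_of_le_of_lt hr h
    refine ⟨?_, fun w hw => ?_⟩
    · rw [mem_closedBall_zero_iff, norm_smul, Real.norm_of_nonneg (by positivity)]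
      field_simp
      exact le_rfl
    · rw [mem_closedBall_zero_iff] at hw
      have h1 : v - (r / ‖v‖) • v = (1 - r / ‖v‖) • v := by rw [sub_smul, one_smul]
      have h2 : 0 ≤ 1 - r / ‖v‖ := by
        rw [sub_nonneg, div_le_one hv]; exact h.le
      rw [h1, norm_smul, Real.norm_of_nonneg h2]
      have h3 : (1 - r / ‖v‖) * ‖v‖ = ‖v‖ - r := by field_simp
      rw [h3]
      have := norm_sub_norm_le v w
      linarith

/-- The projected SGD path started at `θ₀`. The step from time `n` to time `n + 1` uses the
stepsize `γ n` and the sampled index `idx n`, which are usually written `γ_{n+1}` and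
`i_{n+1}`. -/
def projectedSGD {d M : ℕ} (x : Fin M → E d) (y : Fin M → ℝ) (lam r : ℝ) (γ : ℕ → ℝ)
    (idx : ℕ → Fin M) (θ₀ : E d) : ℕ → E d
  | 0 => θ₀
  | n + 1 =>
    let θ := projectedSGD x y lam r γ idx θ₀ n
    projBall r (θ - γ n • gradient (sampleObjective x y lam (idx n)) θ)

end LogisticLandscape

end

/-!
The loss depends on an observation only through the signed covariate `Z = Y X`, and its curvature
at `θ` is `1 / (2 + 2 cosh ⟨θ, Z⟩)` times the rank-one form `⟨u, Z⟩²`. On a segment this curvature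
is at least its smaller endpoint value (`logLoss_lower`), so everything reduces to a lower bound
for averages of `truncCurv K θ θ' u Z`, the endpoint bound with `⟨u, Z⟩²` truncated at `K²`.

*Population.* Sub-Gaussian tails bound the second and fourth moments of linear forms of `Z`, and
with `𝔼 X Xᵀ ⪰ ϖ τ² I` they give `𝔼 truncCurv ≥ κ` on the ball with `κ` independent of the
dimension (`HasMomentBounds.truncCurv_ge`). Hence the population risk is strongly convex on the
ball; its gradient vanishes at the true parameter because the score is centred given `X`.

*Sample.* `truncCurv` is bounded, and Lipschitz in `(θ, θ', u)` with a constant proportional to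
`‖Z‖`. Hoeffding's inequality on a grid with `poly(d)` points per coordinate, together with Markov's
inequality for the average of `‖Z‖`, gives an empirical curvature of at least `κ / 2` everywhere on
the ball (`measureReal_not_curvature_le`). The logarithm of the cardinality of the grid is of order
`d log d`, which `M ≥ C d log M` absorbs. Chebyshev's inequality makes the empirical gradient at the
true parameter small. The regularizer has curvature at least `-2` and gradient at most `2 ‖θ‖`, so
for small `λ` the empirical objective stays strongly convex, and its values on the sphere exceed the
value at the true parameter. So its minimizer over the ball is interior, and it is the only
stationary point there (`exists_isUniqueStationaryMinimizer`).

*Stochastic gradient descent.* Strong convexity makes the mean gradient point away from the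
minimizer. The squared distance of the iterates to it, minus a constant times the partial sums of
`γₙ²`, is then a bounded supermartingale, so the squared distance converges almost surely. Its mean
cannot stay away from zero because `∑ γₙ = ∞`, so the limit is zero
(`ae_tendsto_of_projected_step`).
-/

noncomputable section

namespace LogisticLandscape

/-! ### The scalar logistic loss -/

/-- The scalar logistic loss `s ↦ log (1 + e^{-s})`. -/
def logLoss (s : ℝ) : ℝ := Real.log (1 + Real.exp (-s))

/-- The derivative of `logLoss`. -/
def logLossDeriv (s : ℝ) : ℝ := -(1 / (1 + Real.exp s))

/-- The second derivative of `logLoss`. The form `1 / (2 + 2 cosh s)` displays that it is even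
and decreasing in `|s|`. -/
def logLossCurv (s : ℝ) : ℝ := 1 / (2 + 2 * Real.cosh s)

lemma continuous_logLoss : Continuous logLoss := by
  unfold logLoss
  exact Continuous.log (by fun_prop) fun s => by positivity

lemma continuous_logLossDeriv : Continuous logLossDeriv := by
  unfold logLossDeriv
  exact (Continuous.div₀ (by fun_prop) (by fun_prop) fun s => by positivity).neg

lemma continuous_logLossCurv : Continuous logLossCurv := by
  unfold logLossCurv
  exact Continuous.div₀ (by fun_prop) (by fun_prop)
    fun s => by have := Real.cosh_pos s; positivity

lemma hasDerivAt_logLoss (s : ℝ) : HasDerivAt logLoss (logLossDeriv s) s := by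
  have h1 : HasDerivAt (fun s : ℝ => 1 + Real.exp (-s)) (Real.exp (-s) * (-1)) s :=
    ((hasDerivAt_neg s).exp).const_add 1
  have h2 := h1.log (by positivity)
  convert! h2 using 1
  unfold logLossDeriv
  rw [Real.exp_neg]
  have := Real.exp_pos s
  field_simp
  ring

lemma hasDerivAt_logLossDeriv (s : ℝ) : HasDerivAt logLossDeriv (logLossCurv s) s := by
  have h1 : HasDerivAt (fun s : ℝ => 1 + Real.exp s) (Real.exp s) s :=
    (Real.hasDerivAt_exp s).const_add 1
  have h2 := (h1.inv (by positivity)).neg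
  convert! h2 using 1
  · ext s; simp [logLossDeriv]
  · unfold logLossCurv
    rw [Real.cosh_eq, Real.exp_neg]
    have := Real.exp_pos s
    field_simp
    ring

lemma logLossCurv_pos (s : ℝ) : 0 < logLossCurv s := by
  unfold logLossCurv; have := Real.cosh_pos s; positivity

lemma logLossCurv_le (s : ℝ) : logLossCurv s ≤ 1 / 4 := by
  unfold logLossCurv
  have := Real.one_le_cosh s
  exact one_div_le_one_div_of_le (by norm_num) (by linarith)

lemma logLossCurv_anti {s t : ℝ} (h : |s| ≤ |t|) : logLossCurv t ≤ logLossCurv s := by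
  unfold logLossCurv
  have := Real.cosh_le_cosh.2 h
  have := Real.cosh_pos s
  exact one_div_le_one_div_of_le (by positivity) (by linarith)

lemma abs_logLossDeriv_le (s : ℝ) : |logLossDeriv s| ≤ 1 := by
  unfold logLossDeriv
  have := Real.exp_pos s
  rw [abs_neg, abs_of_pos (by positivity), div_le_one (by positivity)]
  linarith

lemma logLoss_nonneg (s : ℝ) : 0 ≤ logLoss s :=
  Real.log_nonneg (by have := Real.exp_pos (-s); linarith)

lemma abs_logLossCurv_sub_le (s t : ℝ) : |logLossCurv s - logLossCurv t| ≤ |s - t| := by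
  have hd : ∀ x : ℝ, HasDerivAt logLossCurv
      (-(2 * Real.sinh x) / (2 + 2 * Real.cosh x) ^ 2) x := fun x => by
    have hc := Real.cosh_pos x
    have h1 : HasDerivAt (fun s : ℝ => 2 + 2 * Real.cosh s) (2 * Real.sinh x) x :=
      ((Real.hasDerivAt_cosh x).const_mul 2).const_add 2
    convert! h1.inv (by positivity) using 1
    ext s; simp [logLossCurv]
  have := convex_univ.norm_image_sub_le_of_norm_hasDerivWithin_le (f := logLossCurv) (C := 1)
    (fun x _ => (hd x).hasDerivWithinAt) (fun x _ => ?_) (Set.mem_univ t) (Set.mem_univ s)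
  · simpa using this
  · have hc := Real.one_le_cosh x
    have hs : |Real.sinh x| ≤ Real.cosh x := by
      rw [abs_le]
      have h1 := Real.cosh_add_sinh x
      have h2 := Real.cosh_sub_sinh x
      have h3 := Real.exp_pos x
      have h4 := Real.exp_pos (-x)
      constructor <;> linarith
    rw [Real.norm_eq_abs, abs_div, abs_neg, abs_mul, abs_two, abs_of_pos (a := (_ : ℝ) ^ 2)
      (by positivity), div_le_one (by positivity)]
    nlinarith

/-- A second-order lower bound for a function whose second derivative is at least `m` on the unit
interval. -/
lemma add_half_le_of_le_deriv2 {φ φ' φ'' : ℝ → ℝ} {m : ℝ} (h1 : ∀ t, HasDerivAt φ (φ' t) t)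
    (h2 : ∀ t, HasDerivAt φ' (φ'' t) t) (hm : ∀ t ∈ Set.Icc (0 : ℝ) 1, m ≤ φ'' t) :
    φ 0 + φ' 0 + m / 2 ≤ φ 1 := by
  have key1 : ∀ t ∈ Set.Icc (0 : ℝ) 1, φ' 0 + m * t ≤ φ' t := by
    have hd : ∀ t, HasDerivAt (fun t => φ' t - m * t) (φ'' t - m) t := fun t => by
      refine ((h2 t).sub ((hasDerivAt_id t).const_mul m)).congr_deriv ?_
      simp
    have hmono : MonotoneOn (fun t => φ' t - m * t) (Set.Icc 0 1) := by
      refine monotoneOn_of_deriv_nonneg (convex_Icc _ _)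
        (fun t _ => (hd t).continuousAt.continuousWithinAt)
        (fun t _ => (hd t).differentiableAt.differentiableWithinAt) fun t ht => ?_
      rw [(hd t).deriv]
      linarith [hm t (interior_subset ht)]
    intro t ht
    have := hmono (Set.left_mem_Icc.2 zero_le_one) ht ht.1
    simp only [mul_zero, sub_zero] at this
    linarith
  have hd : ∀ t, HasDerivAt (fun t => φ t - φ' 0 * t - m / 2 * t ^ 2)
      (φ' t - φ' 0 - m * t) t := fun t => by
    have h := ((h1 t).sub ((hasDerivAt_id t).const_mul (φ' 0))).sub
      ((hasDerivAt_pow 2 t).const_mul (m / 2))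
    refine h.congr_deriv ?_
    simp; ring
  have hmono : MonotoneOn (fun t => φ t - φ' 0 * t - m / 2 * t ^ 2) (Set.Icc 0 1) := by
    refine monotoneOn_of_deriv_nonneg (convex_Icc _ _)
      (fun t _ => (hd t).continuousAt.continuousWithinAt)
      (fun t _ => (hd t).differentiableAt.differentiableWithinAt) fun t ht => ?_
    rw [(hd t).deriv]
    linarith [key1 t (interior_subset ht)]
  have := hmono (Set.left_mem_Icc.2 zero_le_one) (Set.right_mem_Icc.2 zero_le_one) zero_le_one
  simp only [mul_zero, mul_one] at this
  norm_num at this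
  linarith

lemma hasDerivAt_comp_segment {f f' : ℝ → ℝ} (hf : ∀ s, HasDerivAt f (f' s) s) (s v t : ℝ) :
    HasDerivAt (fun t => f (s + t * v)) (f' (s + t * v) * v) t := by
  have : HasDerivAt (fun t : ℝ => s + t * v) v t := by
    simpa using ((hasDerivAt_id t).mul_const v).const_add s
  exact (hf _).comp t this

/-- The curvature of the loss between `s` and `t` is at least its smaller endpoint value, because
it decreases in `|·|`. -/
lemma logLoss_lower (s t : ℝ) :
    logLoss s + logLossDeriv s * (t - s)
      + min (logLossCurv s) (logLossCurv t) * (t - s) ^ 2 / 2 ≤ logLoss t := by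
  have := add_half_le_of_le_deriv2 (φ := fun a => logLoss (s + a * (t - s)))
    (φ' := fun a => logLossDeriv (s + a * (t - s)) * (t - s))
    (φ'' := fun a => logLossCurv (s + a * (t - s)) * (t - s) * (t - s))
    (m := min (logLossCurv s) (logLossCurv t) * (t - s) ^ 2)
    (hasDerivAt_comp_segment hasDerivAt_logLoss s (t - s))
    (fun a => (hasDerivAt_comp_segment hasDerivAt_logLossDeriv s (t - s) a).mul_const _)
    (fun a ha => ?_)
  · simpa using this
  · rw [mul_assoc, ← pow_two]
    refine mul_le_mul_of_nonneg_right ?_ (sq_nonneg _)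
    have hseg : |s + a * (t - s)| ≤ max |s| |t| := by
      have h : s + a * (t - s) = (1 - a) * s + a * t := by ring
      calc |s + a * (t - s)| ≤ (1 - a) * |s| + a * |t| := by
            rw [h]
            refine (abs_add_le _ _).trans_eq ?_
            rw [abs_mul, abs_mul, abs_of_nonneg ha.1, abs_of_nonneg (sub_nonneg.2 ha.2)]
        _ ≤ (1 - a) * max |s| |t| + a * max |s| |t| := by
            gcongr
            · exact sub_nonneg.2 ha.2
            · exact le_max_left _ _
            · exact ha.1
            · exact le_max_right _ _
        _ = _ := by ring
    rcases le_total |s| |t| with h | h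
    · rw [max_eq_right h] at hseg
      exact (min_le_right _ _).trans (logLossCurv_anti hseg)
    · rw [max_eq_left h] at hseg
      exact (min_le_left _ _).trans (logLossCurv_anti hseg)

lemma logLoss_upper (s t : ℝ) :
    logLoss t ≤ logLoss s + logLossDeriv s * (t - s) + (t - s) ^ 2 := by
  have := add_half_le_of_le_deriv2 (φ := fun a => -logLoss (s + a * (t - s)))
    (φ' := fun a => -(logLossDeriv (s + a * (t - s)) * (t - s)))
    (φ'' := fun a => -(logLossCurv (s + a * (t - s)) * (t - s) * (t - s)))
    (m := -(2 * (t - s) ^ 2))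
    (fun a => (hasDerivAt_comp_segment hasDerivAt_logLoss s (t - s) a).neg)
    (fun a => ((hasDerivAt_comp_segment hasDerivAt_logLossDeriv s (t - s) a).mul_const _).neg)
    (fun a _ => ?_)
  · simp only [zero_mul, add_zero, one_mul, add_sub_cancel] at this
    linarith
  · rw [neg_le_neg_iff, mul_assoc, ← pow_two]
    refine mul_le_mul_of_nonneg_right ?_ (sq_nonneg _)
    linarith [logLossCurv_le (s + a * (t - s))]

/-! ### Quadratic bounds and gradients -/

/-- A function with a quadratic two-sided first-order expansion at `θ` has the linear coefficient
as its gradient. -/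
lemma hasGradientAt_of_abs_sub_le {d : ℕ} {F : E d → ℝ} {g θ : E d} {C : ℝ}
    (h : ∀ θ', |F θ' - F θ - inner ℝ g (θ' - θ)| ≤ C * ‖θ' - θ‖ ^ 2) : HasGradientAt F g θ := by
  rw [hasGradientAt_iff_isLittleO]
  have h1 : (fun θ' => F θ' - F θ - inner ℝ g (θ' - θ)) =O[𝓝 θ] fun θ' => ‖θ' - θ‖ ^ 2 := by
    refine Asymptotics.IsBigO.of_bound C (Eventually.of_forall fun θ' => ?_)
    rw [Real.norm_eq_abs, Real.norm_of_nonneg (by positivity)]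
    exact h θ'
  refine h1.trans_isLittleO ?_
  refine Asymptotics.IsLittleO.of_norm_right (g' := fun θ' => θ' - θ) ?_
  exact (Asymptotics.isLittleO_pow_id one_lt_two).comp_tendsto
    (k := fun θ' : E d => ‖θ' - θ‖) (by
      have : Continuous fun θ' : E d => ‖θ' - θ‖ := by fun_prop
      simpa using this.tendsto θ)

/-- The gradient of the regularizer. -/
def regGrad {d : ℕ} (θ : E d) : E d :=
  WithLp.toLp 2 fun j => 2 * θ j / (1 + θ j ^ 2) ^ 2

lemma inner_eq_sum {d : ℕ} (u v : E d) : inner ℝ u v = ∑ j, u j * v j := by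
  simp [PiLp.inner_apply, mul_comm]

lemma norm_sq_eq_sum {d : ℕ} (u : E d) : ‖u‖ ^ 2 = ∑ j, u j ^ 2 := by
  simp [EuclideanSpace.norm_sq_eq]

lemma continuous_regGrad {d : ℕ} : Continuous (regGrad (d := d)) := by
  unfold regGrad
  refine (PiLp.continuous_toLp 2 _).comp (continuous_pi fun j => ?_)
  exact Continuous.div₀ (by fun_prop) (by fun_prop) fun θ => by positivity

lemma norm_regGrad_le {d : ℕ} (θ : E d) : ‖regGrad θ‖ ≤ 2 * ‖θ‖ := by
  refine abs_le_of_sq_le_sq' ?_ (by positivity) |>.2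
  rw [mul_pow, norm_sq_eq_sum, norm_sq_eq_sum, Finset.mul_sum]
  refine Finset.sum_le_sum fun j _ => ?_
  change (2 * θ j / (1 + θ j ^ 2) ^ 2) ^ 2 ≤ _
  rw [div_pow, mul_pow]
  exact div_le_self (by positivity) (one_le_pow₀ (one_le_pow₀ (by nlinarith [sq_nonneg (θ j)])))

/-- The scalar regularizer `t² / (1 + t²)` differs from its tangent at `t` by at most
`(s - t)²`. -/
lemma abs_scalar_reg_sub_le (s t : ℝ) :
    |s ^ 2 / (1 + s ^ 2) - t ^ 2 / (1 + t ^ 2) - 2 * t / (1 + t ^ 2) ^ 2 * (s - t)|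
      ≤ (s - t) ^ 2 := by
  have h : s ^ 2 / (1 + s ^ 2) - t ^ 2 / (1 + t ^ 2) - 2 * t / (1 + t ^ 2) ^ 2 * (s - t)
      = (s - t) ^ 2 * ((1 - t ^ 2 - 2 * t * s) / ((1 + t ^ 2) ^ 2 * (1 + s ^ 2))) := by
    field_simp
    ring
  rw [h, abs_mul, abs_of_nonneg (sq_nonneg (s - t))]
  refine mul_le_of_le_one_right (sq_nonneg _) ?_
  rw [abs_div, abs_of_pos (a := _ * _) (by positivity), div_le_one (by positivity), abs_le]
  have e : (1 + t ^ 2) ^ 2 * (1 + s ^ 2)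
      = 1 + 2 * t ^ 2 + s ^ 2 + (2 * t ^ 2 * s ^ 2 + t ^ 4 + t ^ 4 * s ^ 2) := by ring
  have p : 0 ≤ 2 * t ^ 2 * s ^ 2 + t ^ 4 + t ^ 4 * s ^ 2 := by positivity
  constructor <;> nlinarith [sq_nonneg (s - t), sq_nonneg (s + t), sq_nonneg t]

lemma abs_regularizer_sub_le {d : ℕ} (θ θ' : E d) :
    |regularizer θ' - regularizer θ - inner ℝ (regGrad θ) (θ' - θ)| ≤ ‖θ' - θ‖ ^ 2 := by
  rw [inner_eq_sum, norm_sq_eq_sum]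
  unfold regularizer
  rw [← Finset.sum_sub_distrib, ← Finset.sum_sub_distrib]
  refine (Finset.abs_sum_le_sum_abs _ _).trans (Finset.sum_le_sum fun j _ => ?_)
  exact abs_scalar_reg_sub_le (θ' j) (θ j)

lemma logisticLoss_eq {d : ℕ} (θ x : E d) (y : ℝ) :
    logisticLoss θ x y = logLoss (inner ℝ θ (y • x)) := by
  unfold logisticLoss logLoss
  rw [inner_smul_right]
  ring_nf

/-! ### The risk of a random vector -/

section Risk

variable {d : ℕ} {S : Type*} [MeasurableSpace S]

/-- The logistic risk `θ ↦ 𝔼 log (1 + e^{-⟨θ, Z⟩})` of a random vector `Z = Y X`. It is the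
population risk when `Z` is drawn from the model and the empirical risk when `Z` is uniform on the
sample. -/
def risk (ν : Measure S) (Z : S → E d) (θ : E d) : ℝ := ∫ s, logLoss (inner ℝ θ (Z s)) ∂ν

/-- The gradient of `risk`. -/
def riskGrad (ν : Measure S) (Z : S → E d) (θ : E d) : E d :=
  ∫ s, logLossDeriv (inner ℝ θ (Z s)) • Z s ∂ν

/-- A lower bound for the curvature of the risk along the segment from `θ` to `θ'`, in the
direction `θ' - θ`. -/
def segCurv (θ θ' z : E d) : ℝ := min (logLossCurv (inner ℝ θ z)) (logLossCurv (inner ℝ θ' z))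

lemma segCurv_nonneg (θ θ' z : E d) : 0 ≤ segCurv θ θ' z :=
  le_min (logLossCurv_pos _).le (logLossCurv_pos _).le

lemma segCurv_le (θ θ' z : E d) : segCurv θ θ' z ≤ 1 :=
  (min_le_left _ _).trans ((logLossCurv_le _).trans (by norm_num))

lemma continuous_segCurv (θ θ' : E d) : Continuous (segCurv θ θ') := by
  unfold segCurv
  exact (continuous_logLossCurv.comp (by fun_prop)).min (continuous_logLossCurv.comp (by fun_prop))

variable {ν : Measure S} {Z : S → E d}

lemma integrable_inner_sq (hZ : MemLp Z 2 ν) (u : E d) :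
    Integrable (fun s => (inner ℝ u (Z s)) ^ 2) ν :=
  (hZ.const_inner u).integrable_sq

lemma integrable_segCurv_mul (hZ : MemLp Z 2 ν) (θ θ' u : E d) :
    Integrable (fun s => segCurv θ θ' (Z s) * (inner ℝ u (Z s)) ^ 2) ν := by
  refine (integrable_inner_sq hZ u).bdd_mul (c := 1)
    ((continuous_segCurv θ θ').comp_aestronglyMeasurable hZ.1) (ae_of_all _ fun s => ?_)
  rw [Real.norm_of_nonneg (segCurv_nonneg _ _ _)]
  exact segCurv_le _ _ _

variable [IsFiniteMeasure ν]

lemma integrable_logLossDeriv_smul (hZ : MemLp Z 2 ν) (θ : E d) :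
    Integrable (fun s => logLossDeriv (inner ℝ θ (Z s)) • Z s) ν := by
  refine Integrable.bdd_smul (φ := fun s => logLossDeriv (inner ℝ θ (Z s)))
    (hZ.integrable one_le_two) 1 ?_ (ae_of_all _ fun s => ?_)
  · exact (continuous_logLossDeriv.comp (by fun_prop :
      Continuous fun z : E d => inner ℝ θ z)).comp_aestronglyMeasurable hZ.1
  · exact abs_logLossDeriv_le _

lemma integrable_logLoss (hZ : MemLp Z 2 ν) (θ : E d) :
    Integrable (fun s => logLoss (inner ℝ θ (Z s))) ν := by
  have h1 : Integrable (fun s => logLoss 0 + logLossDeriv 0 * inner ℝ θ (Z s)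
      + (inner ℝ θ (Z s)) ^ 2) ν :=
    ((integrable_const _).add (((hZ.integrable one_le_two).const_inner θ).const_mul _)).add
      (integrable_inner_sq hZ θ)
  refine h1.mono' ?_ (ae_of_all _ fun s => ?_)
  · exact (continuous_logLoss.comp (by fun_prop :
      Continuous fun z : E d => inner ℝ θ z)).comp_aestronglyMeasurable hZ.1
  · rw [Real.norm_of_nonneg (logLoss_nonneg _)]
    simpa using logLoss_upper 0 (inner ℝ θ (Z s))

lemma inner_riskGrad (hZ : MemLp Z 2 ν) (θ v : E d) :
    inner ℝ (riskGrad ν Z θ) v = ∫ s, logLossDeriv (inner ℝ θ (Z s)) * inner ℝ v (Z s) ∂ν := by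
  rw [real_inner_comm, riskGrad, ← integral_inner (integrable_logLossDeriv_smul hZ θ)]
  simp only [inner_smul_right]

lemma risk_lower (hZ : MemLp Z 2 ν) (θ θ' : E d) :
    risk ν Z θ + inner ℝ (riskGrad ν Z θ) (θ' - θ)
      + (∫ s, segCurv θ θ' (Z s) * (inner ℝ (θ' - θ) (Z s)) ^ 2 ∂ν) / 2 ≤ risk ν Z θ' := by
  have hi : Integrable (fun s => logLossDeriv (inner ℝ θ (Z s)) * inner ℝ (θ' - θ) (Z s)) ν := by
    simpa only [inner_smul_right] using
      (integrable_logLossDeriv_smul hZ θ).const_inner (𝕜 := ℝ) (θ' - θ)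
  have ha : Integrable (fun s => logLoss (inner ℝ θ (Z s))
      + logLossDeriv (inner ℝ θ (Z s)) * inner ℝ (θ' - θ) (Z s)) ν :=
    (integrable_logLoss hZ θ).add hi
  have hq := (integrable_segCurv_mul hZ θ θ' (θ' - θ)).div_const 2
  rw [inner_riskGrad hZ, risk, risk, ← integral_div, ← integral_add (integrable_logLoss hZ θ) hi,
    ← integral_add ha hq]
  refine integral_mono (ha.add hq) (integrable_logLoss hZ θ') fun s => ?_
  have := logLoss_lower (inner ℝ θ (Z s)) (inner ℝ θ' (Z s))
  simp only [inner_sub_left]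
  exact this

lemma risk_upper (hZ : MemLp Z 2 ν) (θ θ' : E d) :
    risk ν Z θ' ≤ risk ν Z θ + inner ℝ (riskGrad ν Z θ) (θ' - θ)
      + (∫ s, ‖Z s‖ ^ 2 ∂ν) * ‖θ' - θ‖ ^ 2 := by
  have hi : Integrable (fun s => logLossDeriv (inner ℝ θ (Z s)) * inner ℝ (θ' - θ) (Z s)) ν := by
    simpa only [inner_smul_right] using
      (integrable_logLossDeriv_smul hZ θ).const_inner (𝕜 := ℝ) (θ' - θ)
  have hq : Integrable (fun s => ‖Z s‖ ^ 2 * ‖θ' - θ‖ ^ 2) ν :=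
    (hZ.integrable_norm_pow two_ne_zero).mul_const _
  have ha : Integrable (fun s => logLoss (inner ℝ θ (Z s))
      + logLossDeriv (inner ℝ θ (Z s)) * inner ℝ (θ' - θ) (Z s)) ν :=
    (integrable_logLoss hZ θ).add hi
  rw [inner_riskGrad hZ, risk, risk, ← integral_mul_const,
    ← integral_add (integrable_logLoss hZ θ) hi, ← integral_add ha hq]
  refine integral_mono (integrable_logLoss hZ θ') (ha.add hq) fun s => ?_
  have h1 := logLoss_upper (inner ℝ θ (Z s)) (inner ℝ θ' (Z s))
  have h2 : (inner ℝ (θ' - θ) (Z s)) ^ 2 ≤ ‖Z s‖ ^ 2 * ‖θ' - θ‖ ^ 2 := by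
    rw [← mul_pow, mul_comm]
    exact sq_le_sq.2 ((abs_real_inner_le_norm _ _).trans (le_abs_self _))
  simp only [inner_sub_left] at h2 ⊢
  linarith

lemma hasGradientAt_risk (hZ : MemLp Z 2 ν) (θ : E d) :
    HasGradientAt (risk ν Z) (riskGrad ν Z θ) θ := by
  refine hasGradientAt_of_abs_sub_le (C := ∫ s, ‖Z s‖ ^ 2 ∂ν) fun θ' => ?_
  have h1 := risk_lower hZ θ θ'
  have h2 := risk_upper hZ θ θ'
  have h3 : 0 ≤ ∫ s, segCurv θ θ' (Z s) * (inner ℝ (θ' - θ) (Z s)) ^ 2 ∂ν :=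
    integral_nonneg fun s => mul_nonneg (segCurv_nonneg _ _ _) (sq_nonneg _)
  have h4 : 0 ≤ (∫ s, ‖Z s‖ ^ 2 ∂ν) * ‖θ' - θ‖ ^ 2 :=
    mul_nonneg (integral_nonneg fun s => by positivity) (by positivity)
  rw [abs_le]
  constructor <;> linarith

end Risk

/-! ### Landscape of a strongly convex function on a ball -/

/-- A stationary point of a differentiable function that is strongly convex on `S` is its only
stationary point in `S` and its unique minimizer over `S`. -/
lemma isUniqueStationaryMinimizer_of_strongConvex {d : ℕ} {F : E d → ℝ} {G : E d → E d}
    {S : Set (E d)} {κ : ℝ} (hκ : 0 < κ)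
    (hF : ∀ θ ∈ S, ∀ θ' ∈ S, F θ + inner ℝ (G θ) (θ' - θ) + κ * ‖θ' - θ‖ ^ 2 ≤ F θ')
    (hG : ∀ θ, HasGradientAt F (G θ) θ) {θ : E d} (hθ : θ ∈ S) (h0 : G θ = 0) :
    IsUniqueStationaryMinimizer F S θ := by
  have hmin : ∀ θ' ∈ S, θ' ≠ θ → F θ < F θ' := fun θ' hθ' hne => by
    have := hF θ hθ θ' hθ'
    rw [h0, inner_zero_left] at this
    have hp : 0 < κ * ‖θ' - θ‖ ^ 2 := by
      have := norm_pos_iff.2 (sub_ne_zero.2 hne)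
      positivity
    linarith
  refine ⟨hθ, ?_, fun θ' hθ' hst => ?_, hmin⟩
  · have := hG θ
    rwa [h0] at this
  · by_contra hne
    have h1 : G θ' = 0 := by
      rw [← (hG θ').gradient]
      exact HasGradientAt.gradient hst
    have := hF θ' hθ' θ hθ
    rw [h1, inner_zero_left] at this
    have h2 := hmin θ' hθ' hne
    have : 0 ≤ κ * ‖θ - θ'‖ ^ 2 := by positivity
    linarith

/-- If the gradient at a point of the half-radius ball is small compared with the strong convexity
constant, then the values on the sphere exceed the value at that point, so the minimum over the
ball is attained in its interior. -/
lemma exists_isUniqueStationaryMinimizer {d : ℕ} {F : E d → ℝ} {G : E d → E d} {r κ : ℝ}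
    (hr : 0 < r) (hκ : 0 < κ)
    (hF : ∀ θ ∈ Metric.closedBall (0 : E d) r, ∀ θ' ∈ Metric.closedBall (0 : E d) r,
      F θ + inner ℝ (G θ) (θ' - θ) + κ * ‖θ' - θ‖ ^ 2 ≤ F θ')
    (hG : ∀ θ, HasGradientAt F (G θ) θ) {θ₀ : E d} (hθ₀ : ‖θ₀‖ ≤ r / 2)
    (hsmall : ‖G θ₀‖ < κ * r / 2) :
    ∃ θ, IsUniqueStationaryMinimizer F (Metric.closedBall (0 : E d) r) θ ∧ G θ = 0 := by
  have hmem : θ₀ ∈ Metric.closedBall (0 : E d) r := by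
    rw [mem_closedBall_zero_iff]; linarith
  have hcont : Continuous F := continuous_iff_continuousAt.2 fun θ =>
    (hG θ).hasFDerivAt.continuousAt
  obtain ⟨θ, hθ, hmin⟩ := (isCompact_closedBall (0 : E d) r).exists_isMinOn ⟨θ₀, hmem⟩
    hcont.continuousOn
  have hlt : ‖θ‖ < r := by
    by_contra! hge
    have h1 := hF θ₀ hmem θ hθ
    have h2 : F θ ≤ F θ₀ := hmin hmem
    have h3 : r / 2 ≤ ‖θ - θ₀‖ := by
      have := norm_sub_norm_le θ θ₀
      linarith
    have h4 := neg_le_of_abs_le (abs_real_inner_le_norm (G θ₀) (θ - θ₀))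
    have h5 : ‖G θ₀‖ * ‖θ - θ₀‖ < κ * ‖θ - θ₀‖ * ‖θ - θ₀‖ := by
      refine mul_lt_mul_of_pos_right (hsmall.trans_le ?_) (by linarith)
      rw [mul_div_assoc]
      exact mul_le_mul_of_nonneg_left h3 hκ.le
    nlinarith
  have hloc : IsLocalMin F θ := by
    refine hmin.isLocalMin (mem_of_superset (Metric.isOpen_ball.mem_nhds ?_)
      Metric.ball_subset_closedBall)
    rwa [mem_ball_zero_iff]
  have h0 : G θ = 0 := by
    have := hloc.hasFDerivAt_eq_zero (hG θ).hasFDerivAt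
    simpa using this
  exact ⟨θ, isUniqueStationaryMinimizer_of_strongConvex hκ hF hG hθ h0, h0⟩

/-! ### Projection onto the ball -/

lemma projBall_mem {d : ℕ} {r : ℝ} (hr : 0 ≤ r) (v : E d) : ‖projBall r v‖ ≤ r :=
  mem_closedBall_zero_iff.1 (projBall_spec hr v).1

/-- Projecting onto the ball does not increase the distance to a point of the ball. -/
lemma norm_projBall_sub_le {d : ℕ} {r : ℝ} (hr : 0 ≤ r) (v : E d) {w : E d} (hw : ‖w‖ ≤ r) :
    ‖projBall r v - w‖ ≤ ‖v - w‖ := by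
  unfold projBall
  split_ifs with h
  · exact le_rfl
  push Not at h
  have hv : 0 < ‖v‖ := lt_of_le_of_lt hr h
  set a := r / ‖v‖ with ha
  have ha1 : a < 1 := (div_lt_one hv).2 h
  have ha0 : 0 ≤ a := by positivity
  have har : a * ‖v‖ = r := by rw [ha]; field_simp
  have h1 : inner ℝ v w ≤ ‖v‖ * r :=
    (real_inner_le_norm v w).trans (mul_le_mul_of_nonneg_left hw hv.le)
  refine abs_le_of_sq_le_sq' ?_ (norm_nonneg _) |>.2
  rw [norm_sub_sq_real, norm_sub_sq_real, inner_smul_left, norm_smul, Real.norm_of_nonneg ha0]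
  simp only [RCLike.conj_to_real]
  nlinarith [mul_nonneg (sub_nonneg.2 ha1.le) (sub_nonneg.2 h1), mul_pos hv hv]

lemma measurable_projBall {d : ℕ} (r : ℝ) : Measurable (projBall (d := d) r) := by
  unfold projBall
  exact Measurable.ite (measurableSet_le measurable_norm measurable_const) measurable_id
    (by fun_prop)

/-! ### Almost sure convergence of projected stochastic gradient descent -/

/-- If `e (n + 1) ≤ e n - b n * e n + a n` with `∑ b n = ∞` and `∑ a n < ∞`, then the
nonnegative sequence `e` cannot stay away from zero. -/
lemma frequently_lt_of_recursion {e a b : ℕ → ℝ} (he : ∀ n, 0 ≤ e n) (ha : ∀ n, 0 ≤ a n)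
    (hb : ∀ n, 0 ≤ b n) (hsa : Summable a)
    (hsb : Tendsto (fun N => ∑ n ∈ Finset.range N, b n) atTop atTop)
    (hrec : ∀ n, e (n + 1) ≤ e n - b n * e n + a n) {ε : ℝ} (hε : 0 < ε) :
    ∃ᶠ n in atTop, e n < ε := by
  by_contra hcon
  rw [not_frequently, eventually_atTop] at hcon
  obtain ⟨N, hN⟩ := hcon
  have key : ∀ m, e (N + m) + ε * ∑ n ∈ Finset.range m, b (N + n)
      ≤ e N + ∑ n ∈ Finset.range m, a (N + n) := by
    intro m
    induction m with
    | zero => simp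
    | succ m ih =>
      rw [Finset.sum_range_succ, Finset.sum_range_succ]
      have h1 := hrec (N + m)
      have h2 := mul_le_mul_of_nonneg_left (not_lt.1 (hN (N + m) (by omega))) (hb (N + m))
      rw [← add_assoc N m 1]
      nlinarith
  obtain ⟨m, hm⟩ := ((tendsto_atTop.1 hsb
    ((e N + ∑' n, a n + 1) / ε + ∑ n ∈ Finset.range N, b n)).and
      (eventually_ge_atTop N)).exists
  obtain ⟨k, rfl⟩ := Nat.exists_eq_add_of_le hm.2
  have h1 := hm.1
  rw [Finset.sum_range_add] at h1
  have h2 : (e N + ∑' n, a n + 1) / ε ≤ ∑ n ∈ Finset.range k, b (N + n) := by linarith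
  rw [div_le_iff₀ hε] at h2
  have h3 : ∑ n ∈ Finset.range k, a (N + n) ≤ ∑' n, a n := by
    have h4 := hsa.sum_le_tsum (Finset.range (N + k)) fun i _ => ha i
    rw [Finset.sum_range_add] at h4
    have : 0 ≤ ∑ n ∈ Finset.range N, a n := Finset.sum_nonneg fun i _ => ha i
    linarith
  have h4 := key k
  have h5 := he (N + k)
  linarith

section SGD

variable {d M : ℕ} {Ω : Type*} [mΩ : MeasurableSpace Ω]

/-- The filtration generated by the sampled indices up to and including time `n`. -/
def indexFiltration (idx : ℕ → Ω → Fin M) (hidx : ∀ n, Measurable (idx n)) : Filtration ℕ mΩ where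
  seq n := ⨆ j ≤ n, MeasurableSpace.comap (idx j) inferInstance
  mono' _ _ hij := biSup_mono fun _ => ge_trans hij
  le' _ := iSup₂_le fun j _ => (hidx j).comap_le

variable {idx : ℕ → Ω → Fin M} {hidx : ∀ n, Measurable (idx n)}

lemma measurable_indexFiltration (n : ℕ) : Measurable[indexFiltration idx hidx n] (idx n) :=
  Measurable.mono (comap_measurable (idx n))
    (le_iSup₂_of_le (f := fun j (_ : j ≤ n) => MeasurableSpace.comap (idx j) inferInstance)
      n le_rfl le_rfl) le_rfl

/-- The sampled index of the next step is independent of the past: it averages against any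
integrable past-measurable quantity `q j` as a uniform index does. -/
lemma integral_sampled_eq {P : Measure Ω} [IsProbabilityMeasure P] (hind : iIndepFun idx P)
    (hunif : ∀ n j, P.real (idx n ⁻¹' {j}) = 1 / (M : ℝ)) {n : ℕ} {q : Fin M → Ω → ℝ}
    (hq : ∀ j, Measurable[indexFiltration idx hidx n] (q j)) (hqi : ∀ j, Integrable (q j) P) :
    ∫ ω, q (idx (n + 1) ω) ω ∂P = ∫ ω, (1 / (M : ℝ)) * ∑ j, q j ω ∂P := by
  have hindep : Indep (MeasurableSpace.comap (idx (n + 1)) inferInstance)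
      (indexFiltration idx hidx n) P := by
    suffices Indep (⨆ k ∈ ({n + 1} : Set ℕ), MeasurableSpace.comap (idx k) inferInstance)
        (⨆ k ∈ {k | k ≤ n}, MeasurableSpace.comap (idx k) inferInstance) P by
      rwa [iSup_singleton] at this
    exact indep_iSup_of_disjoint (fun k => (hidx k).comap_le) hind (by simp)
  have hdec : ∀ ω, q (idx (n + 1) ω) ω
      = ∑ j, (if idx (n + 1) ω = j then (1 : ℝ) else 0) * q j ω := fun ω => by simp
  have hprod : ∀ j, IndepFun (fun ω => if idx (n + 1) ω = j then (1 : ℝ) else 0) (q j) P := by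
    intro j
    refine indep_of_indep_of_le_left (indep_of_indep_of_le_right hindep (hq j).comap_le) ?_
    exact (Measurable.comp (measurable_of_finite fun i : Fin M => if i = j then (1 : ℝ) else 0)
      (comap_measurable _)).comap_le
  have hind1 : ∀ j, Integrable (fun ω => if idx (n + 1) ω = j then (1 : ℝ) else 0) P := fun j =>
    Integrable.of_bound (((measurable_of_finite fun i : Fin M =>
      if i = j then (1 : ℝ) else 0).comp (hidx _)).aestronglyMeasurable) 1
      (ae_of_all _ fun ω => by split_ifs <;> simp)
  have hval : ∀ j, ∫ ω, (if idx (n + 1) ω = j then (1 : ℝ) else 0) ∂P = 1 / M := fun j => by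
    have : (fun ω => if idx (n + 1) ω = j then (1 : ℝ) else 0)
        = (idx (n + 1) ⁻¹' {j}).indicator 1 := by
      ext ω
      by_cases h : idx (n + 1) ω = j
      · rw [if_pos h, Set.indicator_of_mem (by exact h)]; rfl
      · rw [if_neg h, Set.indicator_of_notMem (by exact h)]
    rw [this, integral_indicator_one (hidx _ (measurableSet_singleton j)), hunif]
  simp_rw [hdec]
  have hmul : ∀ j, Integrable (fun ω => (if idx (n + 1) ω = j then (1 : ℝ) else 0) * q j ω) P :=
    fun j => (hprod j).integrable_mul (hind1 j) (hqi j)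
  rw [integral_finsetSum _ fun j _ => hmul j,
    integral_const_mul, integral_finsetSum _ fun j _ => hqi j, Finset.mul_sum]
  refine Finset.sum_congr rfl fun j _ => ?_
  rw [(hprod j).integral_fun_mul_eq_mul_integral (hind1 j).1 (hqi j).1, hval]

/-- Projected stochastic gradient descent with unbiased gradient samples that are bounded on the
ball converges almost surely to the point `θ` from which the mean gradient field points away. -/
theorem ae_tendsto_of_projected_step {P : Measure Ω} [IsProbabilityMeasure P]
    (hidx : ∀ n, Measurable (idx n)) (hind : iIndepFun idx P)
    (hunif : ∀ n j, P.real (idx n ⁻¹' {j}) = 1 / (M : ℝ))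
    {r κ K : ℝ} (hr : 0 ≤ r) (hκ : 0 < κ) {g : Fin M → E d → E d} (hg : ∀ j, Measurable (g j))
    (hgK : ∀ j v, ‖v‖ ≤ r → ‖g j v‖ ≤ K) {θ : E d} (hθ : ‖θ‖ ≤ r)
    (hmono : ∀ v, ‖v‖ ≤ r → κ * ‖v - θ‖ ^ 2 ≤ (1 / (M : ℝ)) * ∑ j, inner ℝ (g j v) (v - θ))
    {γ : ℕ → ℝ} (hγ : ∀ n, 0 ≤ γ n)
    (hγ1 : Tendsto (fun N => ∑ n ∈ Finset.range N, γ n) atTop atTop)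
    (hγ2 : Summable fun n => γ n ^ 2) {T : ℕ → Ω → E d} {θ₀ : E d} (hT0 : ∀ ω, T 0 ω = θ₀)
    (hT : ∀ n ω, T (n + 1) ω = projBall r (T n ω - γ n • g (idx n ω) (T n ω))) :
    ∀ᵐ ω ∂P, Tendsto (fun n => T n ω) atTop (𝓝 θ) := by
  set ℱ := indexFiltration idx hidx with hℱ
  have hTr : ∀ n ω, ‖T (n + 1) ω‖ ≤ r := fun n ω => by rw [hT]; exact projBall_mem hr _
  have hstep : ∀ n, Measurable fun p : Fin M × E d => projBall r (p.2 - γ n • g p.1 p.2) :=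
    fun n => measurable_from_prod_countable_right fun j =>
      (measurable_projBall r).comp (measurable_id.sub ((hg j).const_smul (γ n)))
  have hTm : ∀ n, Measurable[ℱ n] (T (n + 1)) := by
    intro n
    induction n with
    | zero =>
      have h : T (0 + 1) = (fun p : Fin M × E d => projBall r (p.2 - γ 0 • g p.1 p.2)) ∘
          fun ω => (idx 0 ω, θ₀) := by
        ext1 ω; simp only [Function.comp, hT, hT0]
      rw [h]
      exact (hstep 0).comp ((measurable_indexFiltration 0).prodMk measurable_const)
    | succ n ih =>
      have h : T (n + 1 + 1) =
          (fun p : Fin M × E d => projBall r (p.2 - γ (n + 1) • g p.1 p.2)) ∘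
          fun ω => (idx (n + 1) ω, T (n + 1) ω) := by
        ext1 ω; simp only [Function.comp, hT]
      rw [h]
      exact (hstep (n + 1)).comp ((measurable_indexFiltration (n + 1)).prodMk
        (ih.mono (ℱ.mono n.le_succ) le_rfl))
  -- the squared distance after `n + 1` steps
  set V : ℕ → Ω → ℝ := fun n ω => ‖T (n + 1) ω - θ‖ ^ 2 with hV
  have hV0 : ∀ n ω, 0 ≤ V n ω := fun n ω => by positivity
  have hdist : ∀ n ω, ‖T (n + 1) ω - θ‖ ≤ 2 * r := fun n ω =>
    (norm_sub_le _ _).trans (by linarith [hTr n ω])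
  have hVb : ∀ n ω, V n ω ≤ (2 * r) ^ 2 := fun n ω =>
    pow_le_pow_left₀ (norm_nonneg _) (hdist n ω) 2
  have hVm : ∀ n, Measurable[ℱ n] (V n) := fun n =>
    (by fun_prop : Measurable fun v : E d => ‖v - θ‖ ^ 2).comp (hTm n)
  have hVi : ∀ n, Integrable (V n) P := fun n =>
    Integrable.of_bound (((hVm n).mono (ℱ.le n) le_rfl).aestronglyMeasurable) ((2 * r) ^ 2)
      (ae_of_all _ fun ω => by rw [Real.norm_of_nonneg (hV0 n ω)]; exact hVb n ω)
  -- the one-step inequality, integrated over an event of the past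
  have hone : ∀ n, ∀ s, MeasurableSet[ℱ n] s → ∫ ω in s, V (n + 1) ω ∂P ≤
      ∫ ω in s, V n ω ∂P - 2 * κ * γ (n + 1) * ∫ ω in s, V n ω ∂P
        + K ^ 2 * γ (n + 1) ^ 2 * P.real s := by
    intro n s hs
    have hsΩ : MeasurableSet s := ℱ.le n s hs
    set q : Fin M → Ω → ℝ := fun j =>
      s.indicator fun ω => inner ℝ (g j (T (n + 1) ω)) (T (n + 1) ω - θ) with hq
    have hqm : ∀ j, Measurable[ℱ n] (q j) := fun j =>
      Measurable.indicator (m := ℱ n) (((hg j).inner (measurable_id.sub_const θ) :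
        Measurable fun v : E d => (inner ℝ (g j v) (v - θ) : ℝ)).comp (hTm n)) hs
    have hqb : ∀ j ω, |q j ω| ≤ K * (2 * r) := by
      intro j ω
      have hK : 0 ≤ K := (norm_nonneg _).trans (hgK j θ hθ)
      by_cases hω : ω ∈ s
      · simp only [hq, Set.indicator_of_mem hω]
        exact (abs_real_inner_le_norm _ _).trans
          (mul_le_mul (hgK j _ (hTr n ω)) (hdist n ω) (norm_nonneg _) hK)
      · simp only [hq, Set.indicator_of_notMem hω, abs_zero]
        positivity
    have hqi : ∀ j, Integrable (q j) P := fun j =>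
      Integrable.of_bound (((hqm j).mono (ℱ.le n) le_rfl).aestronglyMeasurable) _
        (ae_of_all _ (hqb j))
    have hsamp := integral_sampled_eq (hidx := hidx) hind hunif hqm hqi
    have hqidx : Measurable fun ω => q (idx (n + 1) ω) ω :=
      (measurable_from_prod_countable_right (f := fun p : Fin M × Ω => q p.1 p.2)
        fun j => (hqm j).mono (ℱ.le n) le_rfl).comp ((hidx (n + 1)).prodMk measurable_id)
    have hqidxi : Integrable (fun ω => q (idx (n + 1) ω) ω) P :=
      Integrable.of_bound hqidx.aestronglyMeasurable _ (ae_of_all _ fun ω => hqb _ ω)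
    have hlow : κ * ∫ ω in s, V n ω ∂P ≤ ∫ ω, q (idx (n + 1) ω) ω ∂P := by
      rw [hsamp, ← integral_const_mul, ← integral_indicator hsΩ]
      refine integral_mono (((hVi n).const_mul κ).indicator hsΩ)
        ((integrable_finsetSum _ fun j _ => hqi j).const_mul _) fun ω => ?_
      by_cases hω : ω ∈ s
      · simp only [hq, Set.indicator_of_mem hω]
        exact hmono _ (hTr n ω)
      · simp [hq, Set.indicator_of_notMem hω]
    have hpt : ∀ ω ∈ s, V (n + 1) ω ≤
        V n ω - 2 * γ (n + 1) * q (idx (n + 1) ω) ω + K ^ 2 * γ (n + 1) ^ 2 := by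
      intro ω hω
      simp only [hV, hq, Set.indicator_of_mem hω]
      have h1 := norm_projBall_sub_le hr
        (T (n + 1) ω - γ (n + 1) • g (idx (n + 1) ω) (T (n + 1) ω)) hθ
      rw [← hT] at h1
      refine (pow_le_pow_left₀ (norm_nonneg _) h1 2).trans ?_
      rw [sub_right_comm, norm_sub_sq_real, inner_smul_right, norm_smul, mul_pow,
        Real.norm_eq_abs, sq_abs, real_inner_comm]
      have h2 := mul_le_mul_of_nonneg_left (pow_le_pow_left₀ (norm_nonneg _)
        (hgK (idx (n + 1) ω) _ (hTr n ω)) 2) (sq_nonneg (γ (n + 1)))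
      linarith
    have hint1 : Integrable (fun ω => V n ω - 2 * γ (n + 1) * q (idx (n + 1) ω) ω) P :=
      (hVi n).sub (hqidxi.const_mul _)
    calc ∫ ω in s, V (n + 1) ω ∂P
        ≤ ∫ ω in s, (V n ω - 2 * γ (n + 1) * q (idx (n + 1) ω) ω + K ^ 2 * γ (n + 1) ^ 2) ∂P :=
          setIntegral_mono_on (hVi _).integrableOn
            (hint1.add (integrable_const _)).integrableOn hsΩ hpt
      _ = ∫ ω in s, V n ω ∂P - 2 * γ (n + 1) * ∫ ω, q (idx (n + 1) ω) ω ∂P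
            + K ^ 2 * γ (n + 1) ^ 2 * P.real s := by
          rw [integral_add hint1.integrableOn (integrable_const _).integrableOn,
            integral_sub (hVi n).integrableOn (hqidxi.const_mul _).integrableOn,
            integral_const_mul, setIntegral_const, smul_eq_mul, mul_comm (P.real s)]
          congr 3
          refine setIntegral_eq_integral_of_forall_compl_eq_zero fun ω hω => ?_
          simp [hq, Set.indicator_of_notMem hω]
      _ ≤ _ := by
          have := mul_le_mul_of_nonneg_left hlow (mul_nonneg zero_le_two (hγ (n + 1)))
          linarith
  -- compensated by the squared stepsizes, the squared distance is a supermartingale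
  set A : ℕ → ℝ := fun n => K ^ 2 * ∑ k ∈ Finset.range (n + 1), γ k ^ 2 with hA
  have hA0 : ∀ n, 0 ≤ A n := fun n =>
    mul_nonneg (sq_nonneg _) (Finset.sum_nonneg fun k _ => sq_nonneg _)
  have hAle : ∀ n, A n ≤ K ^ 2 * ∑' k, γ k ^ 2 := fun n =>
    mul_le_mul_of_nonneg_left (hγ2.sum_le_tsum _ fun k _ => sq_nonneg _) (sq_nonneg _)
  have hAlim : Tendsto A atTop (𝓝 (K ^ 2 * ∑' k, γ k ^ 2)) :=
    ((tendsto_add_atTop_iff_nat 1).2 hγ2.hasSum.tendsto_sum_nat).const_mul _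
  have hsub : Submartingale (fun n ω => A n - V n ω) ℱ P := by
    refine submartingale_of_setIntegral_le_succ (fun n => ?_)
      (fun n => (integrable_const _).sub (hVi n)) fun n s hs => ?_
    · exact (measurable_const.sub (hVm n)).stronglyMeasurable
    · rw [integral_sub (integrable_const _).integrableOn (hVi _).integrableOn,
        integral_sub (integrable_const _).integrableOn (hVi _).integrableOn,
        setIntegral_const, setIntegral_const, smul_eq_mul, smul_eq_mul]
      have h1 := hone n s hs
      have h2 : 0 ≤ 2 * κ * γ (n + 1) * ∫ ω in s, V n ω ∂P :=
        mul_nonneg (mul_nonneg (by positivity) (hγ _)) (integral_nonneg fun ω => hV0 n ω)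
      have h3 : A (n + 1) = A n + K ^ 2 * γ (n + 1) ^ 2 := by
        simp only [hA]
        rw [Finset.sum_range_succ _ (n + 1)]
        ring
      rw [h3]
      nlinarith
  have hbd : ∀ n, eLpNorm (fun ω => A n - V n ω) 1 P
      ≤ (Real.toNNReal (K ^ 2 * ∑' k, γ k ^ 2 + (2 * r) ^ 2) : NNReal) := fun n => by
    refine (eLpNorm_le_of_ae_bound (C := K ^ 2 * ∑' k, γ k ^ 2 + (2 * r) ^ 2)
      (ae_of_all _ fun ω => ?_)).trans_eq ?_
    · rw [Real.norm_eq_abs, abs_le]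
      constructor <;> linarith [hA0 n, hAle n, hV0 n ω, hVb n ω]
    · simp [ENNReal.ofReal]
  have hconv := hsub.exists_ae_tendsto_of_bdd hbd
  have hVconv : ∀ᵐ ω ∂P, ∃ c, Tendsto (fun n => V n ω) atTop (𝓝 c) := by
    filter_upwards [hconv] with ω ⟨c, hc⟩
    exact ⟨_, (hAlim.sub hc).congr fun n => by ring⟩
  -- along a subsequence the mean squared distance tends to zero
  have hfreq : ∀ ε > 0, ∃ᶠ n in atTop, ∫ ω, V n ω ∂P < ε := fun ε hε => by
    refine frequently_lt_of_recursion (a := fun n => K ^ 2 * γ (n + 1) ^ 2)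
      (b := fun n => 2 * κ * γ (n + 1)) (fun n => integral_nonneg fun ω => hV0 n ω)
      (fun n => by positivity) (fun n => mul_nonneg (by positivity) (hγ _))
      (((summable_nat_add_iff 1).2 hγ2).mul_left _) ?_ (fun n => ?_) hε
    · simp_rw [← Finset.mul_sum]
      refine Tendsto.const_mul_atTop (by positivity) ?_
      have h1 : Tendsto (fun N => ∑ n ∈ Finset.range (N + 1), γ n) atTop atTop :=
        (tendsto_add_atTop_iff_nat 1).2 hγ1
      refine (tendsto_atTop_add_const_right _ (-γ 0) h1).congr fun N => ?_
      rw [Finset.sum_range_succ']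
      ring
    · simpa using hone n Set.univ MeasurableSet.univ
  choose! c hc using fun ω (h : ∃ c, Tendsto (fun n => V n ω) atTop (𝓝 c)) => h
  have hlim : ∀ᵐ ω ∂P, Tendsto (fun n => V n ω) atTop (𝓝 (c ω)) := by
    filter_upwards [hVconv] with ω h using hc ω h
  have hmean : Tendsto (fun n => ∫ ω, V n ω ∂P) atTop (𝓝 (∫ ω, c ω ∂P)) :=
    tendsto_integral_of_dominated_convergence (fun _ => (2 * r) ^ 2) (fun n => (hVi n).1)
      (integrable_const _)
      (fun n => ae_of_all _ fun ω => by rw [Real.norm_of_nonneg (hV0 n ω)]; exact hVb n ω) hlim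
  have hc0 : ∀ᵐ ω ∂P, 0 ≤ c ω := by
    filter_upwards [hlim] with ω h using ge_of_tendsto' h fun n => hV0 n ω
  have hci : Integrable c P := by
    refine Integrable.of_bound (aestronglyMeasurable_of_tendsto_ae atTop (fun n => (hVi n).1) hlim)
      ((2 * r) ^ 2) ?_
    filter_upwards [hlim, hc0] with ω h h0
    rw [Real.norm_of_nonneg h0]
    exact le_of_tendsto' h fun n => hVb n ω
  have hint0 : ∫ ω, c ω ∂P = 0 := by
    refine le_antisymm (le_of_forall_pos_le_add fun ε hε => ?_) (integral_nonneg_of_ae hc0)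
    rw [zero_add]
    by_contra! hlt
    exact hfreq ε hε ((hmean.eventually_const_lt hlt).mono fun n hn => not_lt.2 hn.le)
  have hczero := (integral_eq_zero_iff_of_nonneg_ae hc0 hci).1 hint0
  filter_upwards [hlim, hczero] with ω h h0
  rw [h0] at h
  rw [← tendsto_add_atTop_iff_nat 1, tendsto_iff_norm_sub_tendsto_zero]
  have := h.sqrt
  simpa [hV, Real.sqrt_sq (norm_nonneg _)] using this

end SGD

/-! ### Moments of the signed covariate -/

/-- The moment conditions on a random vector `Z` that the landscape argument uses: moments of
linear forms of order two (from both sides) and four. -/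
structure HasMomentBounds {d : ℕ} {S : Type*} [MeasurableSpace S] (ν : Measure S) (Z : S → E d)
    (τ ϖ : ℝ) : Prop where
  memLp : MemLp Z 2 ν
  integrable_pow_four : ∀ u : E d, Integrable (fun s => (inner ℝ u (Z s)) ^ 4) ν
  le_sq : ∀ u : E d, ϖ * τ ^ 2 * ‖u‖ ^ 2 ≤ ∫ s, (inner ℝ u (Z s)) ^ 2 ∂ν
  sq_le : ∀ u : E d, ∫ s, (inner ℝ u (Z s)) ^ 2 ∂ν ≤ 8 * τ ^ 2 * ‖u‖ ^ 2
  pow_four_le : ∀ u : E d, ∫ s, (inner ℝ u (Z s)) ^ 4 ∂ν ≤ 96 * τ ^ 4 * ‖u‖ ^ 4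

lemma pow_le_factorial_mul_exp_add (s : ℝ) {k : ℕ} (hk : Even k) :
    s ^ k ≤ k.factorial * (Real.exp s + Real.exp (-s)) := by
  have h := Real.pow_div_factorial_le_exp |s| (abs_nonneg s) k
  rw [div_le_iff₀' (by positivity), hk.pow_abs] at h
  refine h.trans (mul_le_mul_of_nonneg_left ?_ (by positivity))
  rcases abs_cases s with ⟨h, -⟩ | ⟨h, -⟩ <;> rw [h]
  · linarith [Real.exp_pos (-s)]
  · linarith [Real.exp_pos s]

section Moments

variable {d : ℕ} {μ : Measure (E d)} {τ : ℝ}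

lemma IsSubGaussianLaw.integrable_exp (h : IsSubGaussianLaw μ τ) (h0 : ∫ z, z ∂μ = 0) (u : E d) :
    Integrable (fun x : E d => Real.exp (inner ℝ u x)) μ := by
  simpa [h0] using (h u).1

/-- Even moments of a sub-Gaussian linear form. -/
lemma IsSubGaussianLaw.integral_even_pow_le (hτ : 0 < τ) (h : IsSubGaussianLaw μ τ)
    (h0 : ∫ z, z ∂μ = 0) (u : E d) {k : ℕ} (hk : Even k) (hk0 : k ≠ 0) :
    Integrable (fun x : E d => (inner ℝ u x) ^ k) μ ∧
      ∫ x, (inner ℝ u x) ^ k ∂μ ≤ 4 * k.factorial * τ ^ k * ‖u‖ ^ k := by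
  by_cases hu : u = 0
  · subst hu
    simp [hk0]
  have hnu : 0 < ‖u‖ := norm_pos_iff.2 hu
  set a : ℝ := τ * ‖u‖ with ha
  have ha0 : 0 < a := by positivity
  have hv : ‖a⁻¹ • u‖ = τ⁻¹ := by
    rw [norm_smul, norm_inv, Real.norm_of_nonneg ha0.le, ha]
    field_simp
  have hint : Integrable (fun x : E d => (k.factorial : ℝ) *
      (Real.exp (inner ℝ (a⁻¹ • u) x) + Real.exp (inner ℝ (-(a⁻¹ • u)) x))) μ :=
    ((h.integrable_exp h0 _).add (h.integrable_exp h0 _)).const_mul _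
  have hle : ∀ v : E d, ‖v‖ = τ⁻¹ → ∫ x, Real.exp (inner ℝ v x) ∂μ ≤ 2 := fun v hv => by
    have h1 := (h v).2
    simp only [h0, sub_zero, hv] at h1
    refine h1.trans ?_
    have h2 : τ ^ 2 * τ⁻¹ ^ 2 / 2 = 1 / 2 := by field_simp
    rw [h2]
    have h3 : Real.exp (1 / 2) * Real.exp (1 / 2) = Real.exp 1 := by
      rw [← Real.exp_add]; norm_num
    have h4 := Real.exp_one_lt_d9
    nlinarith [Real.exp_pos (1 / 2)]
  have hpt : ∀ x : E d, (inner ℝ u x) ^ k ≤ a ^ k * ((k.factorial : ℝ) *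
      (Real.exp (inner ℝ (a⁻¹ • u) x) + Real.exp (inner ℝ (-(a⁻¹ • u)) x))) := fun x => by
    have h1 := pow_le_factorial_mul_exp_add (inner ℝ (a⁻¹ • u) x) hk
    have h2 : (inner ℝ u x : ℝ) = a * inner ℝ (a⁻¹ • u) x := by
      rw [inner_smul_left, RCLike.conj_to_real, mul_inv_cancel_left₀ ha0.ne']
    rw [h2, mul_pow, inner_neg_left]
    exact mul_le_mul_of_nonneg_left h1 (by positivity)
  have hI : Integrable (fun x : E d => (inner ℝ u x) ^ k) μ := by
    refine (hint.const_mul (a ^ k)).mono' (by fun_prop) (ae_of_all _ fun x => ?_)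
    rw [Real.norm_of_nonneg (hk.pow_nonneg _)]
    exact hpt x
  refine ⟨hI, (integral_mono hI (hint.const_mul _) hpt).trans ?_⟩
  rw [integral_const_mul, integral_const_mul,
    integral_add (h.integrable_exp h0 _) (h.integrable_exp h0 _)]
  have h1 := hle (a⁻¹ • u) hv
  have h2 := hle (-(a⁻¹ • u)) (by rw [norm_neg, hv])
  rw [ha, mul_pow]
  have h3 : (0 : ℝ) ≤ τ ^ k * ‖u‖ ^ k * k.factorial := by positivity
  nlinarith [mul_le_mul_of_nonneg_left (add_le_add h1 h2) h3]

/-- The signed covariate `Y X`, through which alone the logistic loss depends on `(X, Y)`. -/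
def signedCovariate (p : E d × ℝ) : E d := p.2 • p.1

lemma measurable_signedCovariate : Measurable (signedCovariate (d := d)) := by
  unfold signedCovariate; fun_prop

lemma ae_label_eq [IsProbabilityMeasure μ] (θ : E d) :
    ∀ᵐ p ∂(dataLaw μ θ), p.2 = 1 ∨ p.2 = -1 := by
  have hm : MeasurableSet {p : E d × ℝ | p.2 = 1 ∨ p.2 = -1} :=
    (measurableSet_eq_fun measurable_snd measurable_const).union
      (measurableSet_eq_fun measurable_snd measurable_const)
  refine (Measure.ae_compProd_iff hm).2 (ae_of_all _ fun x => ?_)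
  change ∀ᵐ y ∂(ENNReal.ofReal (labelProb θ x 1) • Measure.dirac (1 : ℝ)
    + ENNReal.ofReal (labelProb θ x (-1)) • Measure.dirac (-1 : ℝ)), y = 1 ∨ y = -1
  rw [ae_add_measure_iff]
  constructor
  · refine Measure.ae_smul_measure ?_ _
    rw [ae_dirac_eq]
    simp
  · refine Measure.ae_smul_measure ?_ _
    rw [ae_dirac_eq]
    simp

instance [IsProbabilityMeasure μ] (θ : E d) : IsProbabilityMeasure (dataLaw μ θ) := by
  unfold dataLaw; infer_instance

lemma measurePreserving_fst_dataLaw [IsProbabilityMeasure μ] (θ : E d) :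
    MeasurePreserving Prod.fst (dataLaw μ θ) μ :=
  ⟨measurable_fst, Measure.fst_compProd _ _⟩

lemma inner_signedCovariate_pow_ae [IsProbabilityMeasure μ] (θ u : E d) {k : ℕ} (hk : Even k) :
    (fun p => (inner ℝ u (signedCovariate p)) ^ k) =ᵐ[dataLaw μ θ]
      fun p => (inner ℝ u p.1) ^ k := by
  filter_upwards [ae_label_eq θ] with p hp
  rw [signedCovariate, inner_smul_right, mul_pow]
  rcases hp with h | h <;> rw [h]
  · simp
  · simp [hk.neg_one_pow]

lemma hasMomentBounds_signedCovariate [IsProbabilityMeasure μ] {ϖ : ℝ} (hτ : 0 < τ)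
    (h : IsSubGaussianLaw μ τ) (h0 : ∫ z, z ∂μ = 0) (hsm : SecondMomentGE μ (ϖ * τ ^ 2))
    (θ : E d) : HasMomentBounds (dataLaw μ θ) signedCovariate τ ϖ := by
  have hI : ∀ (u : E d) {k : ℕ}, Even k → k ≠ 0 →
      Integrable (fun p => (inner ℝ u (signedCovariate p)) ^ k) (dataLaw μ θ) :=
    fun u k hk hk0 => by
      rw [integrable_congr (inner_signedCovariate_pow_ae θ u hk)]
      exact (measurePreserving_fst_dataLaw θ).integrable_comp_of_integrable
        (h.integral_even_pow_le hτ h0 u hk hk0).1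
  have hE : ∀ (u : E d) {k : ℕ}, Even k →
      ∫ p, (inner ℝ u (signedCovariate p)) ^ k ∂(dataLaw μ θ) = ∫ x, (inner ℝ u x) ^ k ∂μ :=
    fun u k hk => by
      rw [integral_congr_ae (inner_signedCovariate_pow_ae θ u hk)]
      have := integral_map (μ := dataLaw μ θ) measurable_fst.aemeasurable
        (f := fun x : E d => (inner ℝ u x : ℝ) ^ k) (by fun_prop)
      rw [(measurePreserving_fst_dataLaw θ).map_eq] at this
      exact this.symm
  have e4 : Even 4 := by decide
  refine ⟨?_, fun u => hI u e4 (by norm_num), fun u => ?_, fun u => ?_, fun u => ?_⟩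
  · rw [memLp_two_iff_integrable_sq_norm measurable_signedCovariate.aestronglyMeasurable]
    have : (fun p : E d × ℝ => ‖signedCovariate p‖ ^ 2)
        = fun p => ∑ j, (inner ℝ (EuclideanSpace.single j (1 : ℝ)) (signedCovariate p)) ^ 2 := by
      ext p
      simp [norm_sq_eq_sum, EuclideanSpace.inner_single_left]
    rw [this]
    exact integrable_finsetSum _ fun j _ => hI _ even_two two_ne_zero
  · rw [hE u even_two]; exact hsm u
  · rw [hE u even_two]
    refine (h.integral_even_pow_le hτ h0 u even_two two_ne_zero).2.trans_eq ?_
    norm_num [Nat.factorial]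
  · rw [hE u e4]
    refine (h.integral_even_pow_le hτ h0 u e4 (by norm_num)).2.trans_eq ?_
    norm_num [Nat.factorial]

/-- The true parameter is stationary for the population risk: given `X`, the score of the label
is centred. -/
lemma riskGrad_dataLaw_eq_zero [IsProbabilityMeasure μ] {θ : E d}
    (hZ : MemLp signedCovariate 2 (dataLaw μ θ)) :
    riskGrad (dataLaw μ θ) signedCovariate θ = 0 := by
  have hI := integrable_logLossDeriv_smul hZ θ
  unfold riskGrad
  unfold dataLaw at hI ⊢
  rw [Measure.integral_compProd hI]
  refine integral_eq_zero_of_ae (ae_of_all _ fun x => ?_)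
  change ∫ y, logLossDeriv (inner ℝ θ (signedCovariate (x, y))) • signedCovariate (x, y)
    ∂(ENNReal.ofReal (labelProb θ x 1) • Measure.dirac (1 : ℝ)
    + ENNReal.ofReal (labelProb θ x (-1)) • Measure.dirac (-1 : ℝ)) = 0
  rw [integral_add_measure ((integrable_dirac (by simp)).smul_measure ENNReal.ofReal_ne_top)
    ((integrable_dirac (by simp)).smul_measure ENNReal.ofReal_ne_top),
    integral_smul_measure, integral_smul_measure, integral_dirac, integral_dirac,
    ENNReal.toReal_ofReal (labelProb_nonneg _ _ _), ENNReal.toReal_ofReal (labelProb_nonneg _ _ _)]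
  simp only [signedCovariate, one_smul, neg_smul, smul_neg, inner_neg_right, smul_smul,
    ← sub_eq_add_neg, ← sub_smul]
  refine smul_eq_zero_of_left ?_ _
  unfold labelProb logLossDeriv
  rw [one_mul, neg_one_mul, Real.exp_neg]
  have := Real.exp_pos (inner ℝ θ x)
  field_simp
  ring

lemma populationRisk_eq (θopt : E d) :
    populationRisk μ θopt = risk (dataLaw μ θopt) signedCovariate := by
  ext θ
  simp only [populationRisk, risk, logisticLoss_eq, signedCovariate]

end Moments

/-! ### Curvature of the risk in expectation -/

section Curvature

variable {d : ℕ} {S : Type*} [MeasurableSpace S] {ν : Measure S} {Z : S → E d} {τ ϖ : ℝ}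

/-- The curvature bound `segCurv` in the direction `u`, truncated at level `K` so as to be
bounded. -/
def truncCurv (K : ℝ) (θ θ' u z : E d) : ℝ := segCurv θ θ' z * min ((inner ℝ u z) ^ 2) (K ^ 2)

lemma truncCurv_nonneg (K : ℝ) (θ θ' u z : E d) : 0 ≤ truncCurv K θ θ' u z :=
  mul_nonneg (segCurv_nonneg _ _ _) (le_min (sq_nonneg _) (sq_nonneg _))

lemma truncCurv_le (K : ℝ) (θ θ' u z : E d) : truncCurv K θ θ' u z ≤ K ^ 2 :=
  (mul_le_of_le_one_left (le_min (sq_nonneg _) (sq_nonneg _)) (segCurv_le _ _ _)).trans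
    (min_le_right _ _)

lemma truncCurv_le_segCurv_mul (K : ℝ) (θ θ' u z : E d) :
    truncCurv K θ θ' u z ≤ segCurv θ θ' z * (inner ℝ u z) ^ 2 :=
  mul_le_mul_of_nonneg_left (min_le_left _ _) (segCurv_nonneg _ _ _)

lemma continuous_truncCurv (K : ℝ) (θ θ' u : E d) : Continuous (truncCurv K θ θ' u) := by
  unfold truncCurv
  exact (continuous_segCurv θ θ').mul (by fun_prop)

lemma logLossCurv_ge_quadratic {T : ℝ} (hT : 0 < T) (s : ℝ) :
    logLossCurv T * (1 - s ^ 2 / T ^ 2) ≤ logLossCurv s := by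
  have hp := logLossCurv_pos T
  rcases le_total |s| |T| with h | h
  · refine (mul_le_of_le_one_right hp.le ?_).trans (logLossCurv_anti h)
    have : 0 ≤ s ^ 2 / T ^ 2 := by positivity
    linarith
  · refine le_trans (mul_nonpos_of_nonneg_of_nonpos hp.le ?_) (logLossCurv_pos s).le
    rw [sub_nonpos, one_le_div (by positivity)]
    exact sq_le_sq.2 h

lemma truncCurv_ge {K T : ℝ} (hK : 0 < K) (hT : 0 < T) (θ θ' u z : E d) :
    logLossCurv T * ((inner ℝ u z) ^ 2 - (inner ℝ u z) ^ 4 / K ^ 2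
      - K ^ 2 * ((inner ℝ θ z) ^ 2 + (inner ℝ θ' z) ^ 2) / T ^ 2) ≤ truncCurv K θ θ' u z := by
  set a : ℝ := inner ℝ u z
  set b : ℝ := inner ℝ θ z
  set c : ℝ := inner ℝ θ' z
  have hp := logLossCurv_pos T
  set m := min (a ^ 2) (K ^ 2) with hm
  have hm0 : 0 ≤ m := le_min (sq_nonneg _) (sq_nonneg _)
  have hmK : m ≤ K ^ 2 := min_le_right _ _
  have h1 : a ^ 2 - a ^ 4 / K ^ 2 ≤ m := by
    have h2 : a ^ 4 / K ^ 2 = a ^ 2 * (a ^ 2 / K ^ 2) := by ring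
    rcases le_total (a ^ 2) (K ^ 2) with h | h
    · rw [hm, min_eq_left h]
      have : 0 ≤ a ^ 4 / K ^ 2 := by positivity
      linarith
    · have : 1 ≤ a ^ 2 / K ^ 2 := by rwa [one_le_div (by positivity)]
      nlinarith [sq_nonneg a]
  have h3 : logLossCurv T * (1 - (b ^ 2 + c ^ 2) / T ^ 2) ≤ segCurv θ θ' z := by
    have hb : 0 ≤ b ^ 2 / T ^ 2 := by positivity
    have hc : 0 ≤ c ^ 2 / T ^ 2 := by positivity
    rw [add_div]
    refine le_min (le_trans ?_ (logLossCurv_ge_quadratic hT b))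
      (le_trans ?_ (logLossCurv_ge_quadratic hT c))
    · exact mul_le_mul_of_nonneg_left (by linarith) hp.le
    · exact mul_le_mul_of_nonneg_left (by linarith) hp.le
  refine le_trans ?_ (mul_le_mul_of_nonneg_right h3 hm0)
  rw [mul_assoc]
  refine mul_le_mul_of_nonneg_left ?_ hp.le
  have h4 : 0 ≤ (b ^ 2 + c ^ 2) / T ^ 2 := by positivity
  have h5 := mul_le_mul_of_nonneg_left hmK h4
  have h6 : K ^ 2 * (b ^ 2 + c ^ 2) / T ^ 2 = (b ^ 2 + c ^ 2) / T ^ 2 * K ^ 2 := by ring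
  rw [h6]
  linarith

variable [IsProbabilityMeasure ν]

lemma integrable_truncCurv (hZ : AEStronglyMeasurable Z ν) (K : ℝ) (θ θ' u : E d) :
    Integrable (fun s => truncCurv K θ θ' u (Z s)) ν :=
  Integrable.of_bound ((continuous_truncCurv K θ θ' u).comp_aestronglyMeasurable hZ) (K ^ 2)
    (ae_of_all _ fun s => by
      rw [Real.norm_of_nonneg (truncCurv_nonneg _ _ _ _ _)]; exact truncCurv_le _ _ _ _ _)

/-- For suitable truncation levels the expected truncated curvature is bounded below, uniformly
over the ball and over the dimension. -/
lemma HasMomentBounds.truncCurv_ge {r : ℝ} (h : HasMomentBounds ν Z τ ϖ) {K T : ℝ} (hK : 0 < K)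
    (hT : 0 < T) (hKτ : 192 * τ ^ 4 ≤ ϖ * τ ^ 2 * K ^ 2)
    (hTK : 64 * K ^ 2 * τ ^ 2 * r ^ 2 ≤ ϖ * τ ^ 2 * T ^ 2) {θ θ' u : E d} (hθ : ‖θ‖ ≤ r)
    (hθ' : ‖θ'‖ ≤ r) (hu : ‖u‖ = 1) :
    logLossCurv T * (ϖ * τ ^ 2 / 4) ≤ ∫ s, truncCurv K θ θ' u (Z s) ∂ν := by
  have i2 := integrable_inner_sq h.memLp
  have i4 := h.integrable_pow_four u
  have hA : Integrable (fun s => (inner ℝ u (Z s)) ^ 2 - (inner ℝ u (Z s)) ^ 4 / K ^ 2) ν :=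
    (i2 u).sub (i4.div_const _)
  have hB : Integrable (fun s => K ^ 2 * ((inner ℝ θ (Z s)) ^ 2 + (inner ℝ θ' (Z s)) ^ 2)
      / T ^ 2) ν := (((i2 θ).add (i2 θ')).const_mul _).div_const _
  refine le_trans ?_ (integral_mono ((hA.sub hB).const_mul (logLossCurv T))
    (integrable_truncCurv h.memLp.1 K θ θ' u)
    fun s => LogisticLandscape.truncCurv_ge hK hT θ θ' u (Z s))
  have hsplit : ∫ s, logLossCurv T * (((inner ℝ u (Z s)) ^ 2 - (inner ℝ u (Z s)) ^ 4 / K ^ 2)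
        - K ^ 2 * ((inner ℝ θ (Z s)) ^ 2 + (inner ℝ θ' (Z s)) ^ 2) / T ^ 2) ∂ν
      = logLossCurv T * (((∫ s, (inner ℝ u (Z s)) ^ 2 ∂ν)
        - (∫ s, (inner ℝ u (Z s)) ^ 4 ∂ν) / K ^ 2)
        - K ^ 2 * ((∫ s, (inner ℝ θ (Z s)) ^ 2 ∂ν) + ∫ s, (inner ℝ θ' (Z s)) ^ 2 ∂ν) / T ^ 2) := by
    rw [integral_const_mul, integral_sub hA hB, integral_sub (i2 u) (i4.div_const _),
      integral_div, integral_div, integral_const_mul, integral_add (i2 θ) (i2 θ')]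
  refine le_trans ?_ hsplit.ge
  refine mul_le_mul_of_nonneg_left ?_ (logLossCurv_pos T).le
  have b1 := h.le_sq u
  have b2 := h.pow_four_le u
  rw [hu] at b1 b2
  have b3 : ∀ v : E d, ‖v‖ ≤ r → ∫ s, (inner ℝ v (Z s)) ^ 2 ∂ν ≤ 8 * τ ^ 2 * r ^ 2 :=
    fun v hv => (h.sq_le v).trans (mul_le_mul_of_nonneg_left
      (pow_le_pow_left₀ (norm_nonneg _) hv 2) (by positivity))
  have c1 : (∫ s, (inner ℝ u (Z s)) ^ 4 ∂ν) / K ^ 2 ≤ ϖ * τ ^ 2 / 2 := by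
    rw [div_le_iff₀ (by positivity)]
    linarith
  have c2 : K ^ 2 * ((∫ s, (inner ℝ θ (Z s)) ^ 2 ∂ν) + ∫ s, (inner ℝ θ' (Z s)) ^ 2 ∂ν) / T ^ 2
      ≤ ϖ * τ ^ 2 / 4 := by
    rw [div_le_iff₀ (by positivity)]
    have := mul_le_mul_of_nonneg_left (add_le_add (b3 θ hθ) (b3 θ' hθ')) (sq_nonneg K)
    linarith
  linarith

/-- A lower bound on the truncated curvature along unit directions bounds the curvature term of the
second-order expansion of the risk. -/
lemma mul_sq_norm_le_integral_segCurv {κ K : ℝ} (hZ : MemLp Z 2 ν) {θ θ' : E d}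
    (h : ∀ u : E d, ‖u‖ = 1 → κ ≤ ∫ s, truncCurv K θ θ' u (Z s) ∂ν) (v : E d) :
    κ * ‖v‖ ^ 2 ≤ ∫ s, segCurv θ θ' (Z s) * (inner ℝ v (Z s)) ^ 2 ∂ν := by
  by_cases hv : v = 0
  · simp [hv]
  have hn : 0 < ‖v‖ := norm_pos_iff.2 hv
  have h1 := h (‖v‖⁻¹ • v) (norm_smul_inv_norm (𝕜 := ℝ) hv)
  have h2 := h1.trans (integral_mono (integrable_truncCurv hZ.1 K θ θ' (‖v‖⁻¹ • v))
    (integrable_segCurv_mul hZ θ θ' (‖v‖⁻¹ • v))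
    fun s => truncCurv_le_segCurv_mul K θ θ' (‖v‖⁻¹ • v) (Z s))
  have h3 : ∫ s, segCurv θ θ' (Z s) * (inner ℝ (‖v‖⁻¹ • v) (Z s)) ^ 2 ∂ν
      = (‖v‖⁻¹) ^ 2 * ∫ s, segCurv θ θ' (Z s) * (inner ℝ v (Z s)) ^ 2 ∂ν := by
    rw [← integral_const_mul]
    refine integral_congr_ae (ae_of_all _ fun s => ?_)
    simp only [inner_smul_left, RCLike.conj_to_real]
    ring
  rw [h3, inv_pow, ← div_eq_inv_mul, le_div_iff₀ (by positivity)] at h2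
  exact h2

end Curvature

/-! ### Finite nets and Lipschitz continuity of the truncated curvature -/

/-- A grid of mesh `η` is a finite `d η`-net of the ball of radius `R`. -/
lemma exists_net (d : ℕ) {R η : ℝ} (hR : 0 ≤ R) (hη : 0 < η) :
    ∃ N : Finset (E d), (N.card : ℝ) ≤ (2 * R / η + 3) ^ d ∧
      ∀ v : E d, ‖v‖ ≤ R → ∃ p ∈ N, ‖v - p‖ ≤ d * η := by
  classical
  set n : ℤ := ⌈R / η⌉ with hn
  have hn0 : 0 ≤ n := Int.ceil_nonneg (by positivity)
  refine ⟨(Fintype.piFinset fun _ : Fin d => Finset.Icc (-n) n).image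
    fun k => WithLp.toLp 2 fun j => η * (k j : ℝ), ?_, fun v hv => ?_⟩
  · refine (Nat.cast_le.2 Finset.card_image_le).trans ?_
    rw [Fintype.card_piFinset_const, Int.card_Icc, Nat.cast_pow]
    refine pow_le_pow_left₀ (Nat.cast_nonneg _) ?_ _
    have h1 : (((n + 1 - -n).toNat : ℤ) : ℝ) = 2 * n + 1 := by
      rw [Int.toNat_of_nonneg (by omega)]; push_cast; ring
    rw [← Int.cast_natCast, h1]
    have h2 : (n : ℝ) < R / η + 1 := Int.ceil_lt_add_one _
    have h3 : 2 * R / η = 2 * (R / η) := by ring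
    rw [h3]; linarith
  · have hcoord : ∀ j, |v j| ≤ R := fun j => by
      have := PiLp.norm_apply_le v j
      exact this.trans hv
    refine ⟨_, Finset.mem_image.2 ⟨fun j => ⌊v j / η⌋, ?_, rfl⟩, ?_⟩
    · rw [Fintype.mem_piFinset]
      intro j
      have hj := abs_le.1 (hcoord j)
      have hc : R / η ≤ n := Int.le_ceil _
      rw [Finset.mem_Icc]
      constructor
      · rw [Int.le_floor]
        push_cast
        have : -(R / η) ≤ v j / η := by
          rw [← neg_div]; exact div_le_div_of_nonneg_right hj.1 hη.le
        linarith
      · have h1 : (⌊v j / η⌋ : ℝ) ≤ n :=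
          (Int.floor_le _).trans ((div_le_div_of_nonneg_right hj.2 hη.le).trans hc)
        exact_mod_cast h1
    · refine abs_le_of_sq_le_sq' ?_ (by positivity) |>.2
      rw [norm_sq_eq_sum]
      have hterm : ∀ j ∈ Finset.univ,
          (v - WithLp.toLp 2 fun j => η * (⌊v j / η⌋ : ℝ)) j ^ 2 ≤ η ^ 2 := fun j _ => by
        change (v j - η * (⌊v j / η⌋ : ℝ)) ^ 2 ≤ η ^ 2
        have h1 := Int.floor_le (v j / η)
        have h2 := Int.lt_floor_add_one (v j / η)
        rw [le_div_iff₀ hη] at h1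
        rw [div_lt_iff₀ hη] at h2
        exact pow_le_pow_left₀ (by linarith) (by linarith) 2
      refine (Finset.sum_le_sum hterm).trans ?_
      rw [Finset.sum_const, Finset.card_univ, Fintype.card_fin, nsmul_eq_mul, mul_pow]
      refine mul_le_mul_of_nonneg_right ?_ (sq_nonneg _)
      rcases Nat.eq_zero_or_pos d with rfl | hd
      · simp
      · exact le_self_pow₀ (by exact_mod_cast hd) two_ne_zero

lemma abs_min_sq_sub_le {K : ℝ} (hK : 0 ≤ K) (a b : ℝ) :
    |min (a ^ 2) (K ^ 2) - min (b ^ 2) (K ^ 2)| ≤ 2 * K * |a - b| := by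
  have h : ∀ c : ℝ, min (c ^ 2) (K ^ 2) = (min |c| K) ^ 2 := fun c => by
    rcases le_total |c| K with h | h
    · rw [min_eq_left h, sq_abs, min_eq_left]
      rw [← sq_abs]; exact pow_le_pow_left₀ (abs_nonneg _) h 2
    · rw [min_eq_right h, min_eq_right]
      rw [← sq_abs c]; exact pow_le_pow_left₀ hK h 2
  rw [h, h, sq_sub_sq, abs_mul]
  have h0 : ∀ c : ℝ, 0 ≤ min |c| K ∧ min |c| K ≤ K := fun c =>
    ⟨le_min (abs_nonneg _) hK, min_le_right _ _⟩
  refine mul_le_mul ?_ ?_ (abs_nonneg _) (by positivity)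
  · rw [abs_of_nonneg (add_nonneg (h0 a).1 (h0 b).1)]
    linarith [(h0 a).2, (h0 b).2]
  · have h1 := abs_min_sub_min_le_max |a| K |b| K
    rw [sub_self, abs_zero, max_eq_left (abs_nonneg _)] at h1
    exact h1.trans (abs_abs_sub_abs_le _ _)

section Lipschitz

variable {d : ℕ}

lemma abs_segCurv_sub_le (θ θ' φ φ' z : E d) :
    |segCurv θ θ' z - segCurv φ φ' z| ≤ (‖θ - φ‖ + ‖θ' - φ'‖) * ‖z‖ := by
  have h : ∀ a b : E d, |logLossCurv (inner ℝ a z) - logLossCurv (inner ℝ b z)|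
      ≤ ‖a - b‖ * ‖z‖ := fun a b => by
    refine (abs_logLossCurv_sub_le _ _).trans ?_
    rw [← inner_sub_left]
    exact abs_real_inner_le_norm _ _
  refine (abs_min_sub_min_le_max _ _ _ _).trans (max_le ?_ ?_)
  · exact (h θ φ).trans (mul_le_mul_of_nonneg_right
      (le_add_of_nonneg_right (norm_nonneg _)) (norm_nonneg _))
  · exact (h θ' φ').trans (mul_le_mul_of_nonneg_right
      (le_add_of_nonneg_left (norm_nonneg _)) (norm_nonneg _))

lemma abs_truncCurv_sub_le {K ε : ℝ} (hK : 0 ≤ K) {θ θ' u φ φ' w : E d} (h1 : ‖θ - φ‖ ≤ ε)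
    (h2 : ‖θ' - φ'‖ ≤ ε) (h3 : ‖u - w‖ ≤ ε) (z : E d) :
    |truncCurv K θ θ' u z - truncCurv K φ φ' w z| ≤ (2 * K ^ 2 + 2 * K) * ε * ‖z‖ := by
  unfold truncCurv
  set m : E d → ℝ := fun u => min ((inner ℝ u z) ^ 2) (K ^ 2) with hm
  have e : segCurv θ θ' z * m u - segCurv φ φ' z * m w
      = (segCurv θ θ' z - segCurv φ φ' z) * m u + segCurv φ φ' z * (m u - m w) := by ring
  change |segCurv θ θ' z * m u - segCurv φ φ' z * m w| ≤ _
  rw [e]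
  have hz := norm_nonneg z
  have a1 : |segCurv θ θ' z - segCurv φ φ' z| ≤ 2 * ε * ‖z‖ :=
    (abs_segCurv_sub_le θ θ' φ φ' z).trans (mul_le_mul_of_nonneg_right (by linarith) hz)
  have a2 : |m u| ≤ K ^ 2 := by
    rw [abs_of_nonneg (le_min (sq_nonneg _) (sq_nonneg _))]; exact min_le_right _ _
  have a3 : |segCurv φ φ' z| ≤ 1 := by
    rw [abs_of_nonneg (segCurv_nonneg _ _ _)]; exact segCurv_le _ _ _
  have a4 : |m u - m w| ≤ 2 * K * (ε * ‖z‖) := by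
    refine (abs_min_sq_sub_le hK _ _).trans (mul_le_mul_of_nonneg_left ?_ (by positivity))
    rw [← inner_sub_left]
    exact (abs_real_inner_le_norm _ _).trans (mul_le_mul_of_nonneg_right h3 hz)
  calc _ ≤ |segCurv θ θ' z - segCurv φ φ' z| * |m u| + |segCurv φ φ' z| * |m u - m w| := by
        rw [← abs_mul, ← abs_mul]; exact abs_add_le _ _
    _ ≤ 2 * ε * ‖z‖ * K ^ 2 + 1 * (2 * K * (ε * ‖z‖)) :=
        add_le_add (mul_le_mul a1 a2 (abs_nonneg _) ((abs_nonneg _).trans a1))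
          (mul_le_mul a3 a4 (abs_nonneg _) zero_le_one)
    _ = _ := by ring

end Lipschitz

/-! ### Concentration of empirical averages -/

/-- The uniform distribution on the index set of the sample. -/
def uniformIndex (M : ℕ) : Measure (Fin M) := (M : ENNReal)⁻¹ • Measure.count

lemma isProbabilityMeasure_uniformIndex {M : ℕ} (hM : M ≠ 0) :
    IsProbabilityMeasure (uniformIndex M) := ⟨by
  rw [uniformIndex, Measure.smul_apply, Measure.count_univ, smul_eq_mul,
    ENat.card_eq_coe_fintype_card, Fintype.card_fin]
  exact ENNReal.inv_mul_cancel (by simpa using hM) (by simp)⟩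

lemma integral_uniformIndex {M : ℕ} {F : Type*} [NormedAddCommGroup F] [NormedSpace ℝ F]
    [CompleteSpace F] (f : Fin M → F) : ∫ i, f i ∂(uniformIndex M) = (1 / (M : ℝ)) • ∑ i, f i := by
  rw [uniformIndex, integral_smul_measure, integral_count]
  simp

section Concentration

variable {d M : ℕ} {S Ω : Type*} [MeasurableSpace S] [MeasurableSpace Ω] {ν : Measure S}
  {P : Measure Ω} {W : Fin M → Ω → S}

/-- Hoeffding's inequality for the lower tail of an empirical average. -/
lemma measureReal_average_le_of_bounded [IsProbabilityMeasure P] (hM : M ≠ 0)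
    (hW : ∀ i, HasLaw (W i) ν P) (hind : iIndepFun W P) {f : S → ℝ} (hf : Measurable f) {b : ℝ}
    (hb : 0 < b) (hf0 : ∀ s, 0 ≤ f s) (hfb : ∀ s, f s ≤ b) {t : ℝ} (ht : 0 ≤ t) :
    P.real {ω | ∫ i, f (W i ω) ∂(uniformIndex M) ≤ ∫ s, f s ∂ν - t}
      ≤ Real.exp (-(2 * t ^ 2 / b ^ 2 * M)) := by
  have hM' : (0 : ℝ) < M := by exact_mod_cast Nat.pos_of_ne_zero hM
  set X : Fin M → Ω → ℝ := fun i ω => -f (W i ω) - ∫ ω, -f (W i ω) ∂P with hX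
  have hsub : ∀ i, HasSubgaussianMGF (X i) ((‖(0 : ℝ) - -b‖₊ / 2) ^ 2) P := fun i =>
    hasSubgaussianMGF_of_mem_Icc (X := fun ω => -f (W i ω))
      ((hf.comp_aemeasurable (hW i).aemeasurable).neg)
      (ae_of_all _ fun ω => ⟨neg_le_neg (hfb _), neg_nonpos.2 (hf0 _)⟩)
  have hindX : iIndepFun X P := by
    have := hind.comp (fun i s => -f s - ∫ ω, -f (W i ω) ∂P) fun i => by fun_prop
    exact this
  have hmean : ∀ i, ∫ ω, f (W i ω) ∂P = ∫ s, f s ∂ν := fun i =>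
    (hW i).integral_comp hf.aestronglyMeasurable
  have key := HasSubgaussianMGF.measure_sum_ge_le_of_iIndepFun hindX (s := Finset.univ)
    (c := fun _ => (‖(0 : ℝ) - -b‖₊ / 2) ^ 2) (fun i _ => hsub i) (ε := M * t) (by positivity)
  have hset : {ω | ∫ i, f (W i ω) ∂(uniformIndex M) ≤ ∫ s, f s ∂ν - t}
      = {ω | M * t ≤ ∑ i, X i ω} := by
    ext ω
    simp only [Set.mem_ofPred_eq, hX, integral_neg, hmean, integral_uniformIndex, smul_eq_mul,
      Finset.sum_sub_distrib, Finset.sum_neg_distrib, Finset.sum_const, Finset.card_univ,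
      Fintype.card_fin, nsmul_eq_mul]
    rw [one_div, inv_mul_le_iff₀ hM', mul_sub]
    constructor <;> intro h <;> linarith
  rw [hset]
  refine key.trans (Real.exp_le_exp.2 (le_of_eq ?_))
  simp only [Finset.sum_const, Finset.card_univ, Fintype.card_fin, nsmul_eq_mul]
  push_cast
  rw [zero_sub, neg_neg, Real.norm_of_nonneg hb.le]
  field_simp

/-- Markov's inequality for an empirical average. -/
lemma measureReal_average_ge_le (hM : M ≠ 0) (hW : ∀ i, HasLaw (W i) ν P) {f : S → ℝ}
    (hf : Integrable f ν) (hf0 : ∀ s, 0 ≤ f s) {a : ℝ} (ha : 0 < a) :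
    P.real {ω | a ≤ ∫ i, f (W i ω) ∂(uniformIndex M)} ≤ (∫ s, f s ∂ν) / a := by
  have hM' : (M : ℝ) ≠ 0 := by exact_mod_cast hM
  have hi : ∀ i, Integrable (fun ω => f (W i ω)) P := fun i => by
    have h1 : Integrable f (Measure.map (W i) P) := by rw [(hW i).map_eq]; exact hf
    exact h1.comp_aemeasurable (hW i).aemeasurable
  have hmean : ∀ i, ∫ ω, f (W i ω) ∂P = ∫ s, f s ∂ν := fun i => (hW i).integral_comp hf.1
  have h := mul_meas_ge_le_integral_of_nonneg (μ := P)
    (f := fun ω => ∫ i, f (W i ω) ∂(uniformIndex M))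
    (ae_of_all _ fun ω => integral_nonneg fun i => hf0 _)
    (by simp only [integral_uniformIndex, smul_eq_mul]
        exact (integrable_finsetSum _ fun i _ => hi i).const_mul _) a
  rw [le_div_iff₀' ha]
  refine h.trans_eq ?_
  simp only [integral_uniformIndex, smul_eq_mul]
  rw [integral_const_mul, integral_finsetSum _ fun i _ => hi i]
  simp only [hmean, Finset.sum_const, Finset.card_univ, Fintype.card_fin, nsmul_eq_mul]
  field_simp

/-- Chebyshev's inequality for the empirical average of a centred random vector. -/
lemma measureReal_norm_average_ge_le [IsFiniteMeasure ν] [IsProbabilityMeasure P] (hM : M ≠ 0)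
    (hW : ∀ i, HasLaw (W i) ν P) (hind : iIndepFun W P) {g : S → E d} (hg : Measurable g)
    (hg2 : MemLp g 2 ν)
    (hg0 : ∫ s, g s ∂ν = 0) {a : ℝ} (ha : 0 < a) :
    P.real {ω | a ≤ ‖∫ i, g (W i ω) ∂(uniformIndex M)‖}
      ≤ (∫ s, ‖g s‖ ^ 2 ∂ν) / (M * a ^ 2) := by
  have hM' : (0 : ℝ) < M := by exact_mod_cast Nat.pos_of_ne_zero hM
  have hgj : ∀ j, Measurable fun s => g s j := fun j => by fun_prop
  have hjL : ∀ j, MemLp (fun s => g s j) 2 ν := fun j =>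
    hg2.of_le (hgj j).aestronglyMeasurable (ae_of_all _ fun s => PiLp.norm_apply_le (g s) j)
  have hji : ∀ j, ∫ s, g s j ∂ν = 0 := fun j => by
    have h1 := integral_inner (𝕜 := ℝ) (hg2.integrable one_le_two) (EuclideanSpace.single j (1 : ℝ))
    simpa [hg0, EuclideanSpace.inner_single_left] using h1
  have hXL : ∀ j i, MemLp (fun ω => g (W i ω) j) 2 P := fun j i => by
    have h1 : MemLp (fun s => g s j) 2 (Measure.map (W i) P) := by
      rw [(hW i).map_eq]; exact hjL j
    exact h1.comp_of_map (hW i).aemeasurable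
  have hX0 : ∀ j i, ∫ ω, g (W i ω) j ∂P = 0 := fun j i => by
    rw [← hji j]
    exact (hW i).integral_comp (f := fun s => g s j) (hgj j).aestronglyMeasurable
  have hX2 : ∀ j i, ∫ ω, (g (W i ω) j) ^ 2 ∂P = ∫ s, (g s j) ^ 2 ∂ν := fun j i =>
    (hW i).integral_comp (f := fun s => g s j ^ 2) ((hgj j).pow_const 2).aestronglyMeasurable
  have hsq : ∀ j, ∫ ω, (∑ i, g (W i ω) j) ^ 2 ∂P = M * ∫ s, (g s j) ^ 2 ∂ν := fun j => by
    have hv := IndepFun.variance_sum (X := fun i ω => g (W i ω) j) (s := Finset.univ)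
      (fun i _ => hXL j i) fun i _ k _ hik =>
        ((hind.indepFun hik).comp (hgj j) (hgj j))
    have hm : AEMeasurable (∑ i, fun ω => g (W i ω) j) P :=
      Finset.aemeasurable_sum _ fun i _ => (hXL j i).1.aemeasurable
    rw [variance_of_integral_eq_zero hm] at hv
    · simp only [Finset.sum_apply] at hv
      rw [hv]
      have : ∀ i, Var[fun ω => g (W i ω) j; P] = ∫ s, (g s j) ^ 2 ∂ν := fun i => by
        rw [variance_of_integral_eq_zero (hXL j i).1.aemeasurable (hX0 j i), hX2]
      simp [this]
    · simp only [Finset.sum_apply]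
      rw [integral_finsetSum _ fun i _ => (hXL j i).integrable one_le_two]
      simp [hX0]
  have hnorm : ∀ ω, ‖∫ i, g (W i ω) ∂(uniformIndex M)‖ ^ 2
      = ∑ j, (1 / (M : ℝ)) ^ 2 * (∑ i, g (W i ω) j) ^ 2 := fun ω => by
    rw [integral_uniformIndex, norm_smul, mul_pow, norm_sq_eq_sum, Finset.mul_sum,
      Real.norm_eq_abs, sq_abs]
    simp
  have hsqi : ∀ j, Integrable (fun ω => (∑ i, g (W i ω) j) ^ 2) P := fun j =>
    (memLp_finsetSum _ fun i _ => hXL j i).integrable_sq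
  have h := mul_meas_ge_le_integral_of_nonneg (μ := P)
    (f := fun ω => ‖∫ i, g (W i ω) ∂(uniformIndex M)‖ ^ 2)
    (ae_of_all _ fun ω => sq_nonneg _)
    (by simp only [hnorm]
        exact integrable_finsetSum _ fun j _ => (hsqi j).const_mul _) (a ^ 2)
  have hset : {ω | a ≤ ‖∫ i, g (W i ω) ∂(uniformIndex M)‖}
      ⊆ {ω | a ^ 2 ≤ ‖∫ i, g (W i ω) ∂(uniformIndex M)‖ ^ 2} :=
    fun ω hω => pow_le_pow_left₀ ha.le hω 2
  refine (measureReal_mono hset).trans ?_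
  rw [le_div_iff₀ (by positivity)]
  have hval : ∫ ω, ‖∫ i, g (W i ω) ∂(uniformIndex M)‖ ^ 2 ∂P = (∫ s, ‖g s‖ ^ 2 ∂ν) / M := by
    simp only [hnorm, norm_sq_eq_sum]
    rw [integral_finsetSum _ fun j _ => (hsqi j).const_mul _,
      integral_finsetSum _ fun j _ => (hjL j).integrable_sq, Finset.sum_div]
    refine Finset.sum_congr rfl fun j _ => ?_
    rw [integral_const_mul, hsq]
    field_simp
  rw [hval, le_div_iff₀ hM'] at h
  linarith

end Concentration

/-- The sample size requirement `M ≥ C d log M` beats the logarithm of the cardinality of a net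
with `poly(d)` points per coordinate. -/
lemma exists_sampleSize_const {A c δ : ℝ} (hA : 1 ≤ A) (hc : 0 < c) (hδ : 0 < δ) :
    ∃ C : ℝ, 0 < C ∧ ∀ d M : ℕ, 1 ≤ d → 2 ≤ M → C * d * Real.log M ≤ M →
      ((A * (d : ℝ) ^ 2) ^ d) ^ 3 * Real.exp (-(c * M)) ≤ δ ∧ (d : ℝ) ≤ δ * M := by
  have hlA := Real.log_nonneg hA
  refine ⟨2 + (6 * Real.log A + 6 + 2 * |Real.log δ|) / c + 2 / δ, by positivity,
    fun d M hd hM h => ?_⟩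
  have hd' : (1 : ℝ) ≤ d := by exact_mod_cast hd
  have hM' : (2 : ℝ) ≤ M := by exact_mod_cast hM
  have hlM : 1 / 2 ≤ Real.log M := by
    have h1 := Real.log_two_gt_d9
    have h2 := Real.log_le_log two_pos hM'
    linarith
  set D : ℝ := d * Real.log M with hD
  have hdD : (d : ℝ) ≤ 2 * D := by rw [hD]; nlinarith
  have hD0 : 1 / 2 ≤ D := by linarith
  have hB : 0 ≤ (6 * Real.log A + 6 + 2 * |Real.log δ|) / c := by positivity
  have hE : 0 ≤ 2 / δ := by positivity
  have h' : (2 + (6 * Real.log A + 6 + 2 * |Real.log δ|) / c + 2 / δ) * D ≤ M := by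
    rw [hD, ← mul_assoc]; exact h
  have h1 : 2 * D ≤ M := by nlinarith
  have h2 : (6 * Real.log A + 6 + 2 * |Real.log δ|) / c * D ≤ M := by nlinarith
  have h3 : 2 / δ * D ≤ M := by nlinarith
  constructor
  · have hp : 0 < A * (d : ℝ) ^ 2 := by positivity
    rw [← Real.exp_log hδ, ← pow_mul, ← Real.exp_log hp, ← Real.exp_nat_mul, ← Real.exp_add,
      Real.exp_le_exp, Real.log_mul (by positivity) (by positivity), Real.log_pow]
    push_cast
    have hld : Real.log d ≤ Real.log M :=
      Real.log_le_log (by positivity) (by linarith)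
    have h4 : (6 * Real.log A + 6 + 2 * |Real.log δ|) * D ≤ c * M := by
      have := mul_le_mul_of_nonneg_left h2 hc.le
      rw [← mul_assoc, mul_div_cancel₀ _ hc.ne'] at this
      exact this
    have h5 : (d : ℝ) * Real.log d ≤ D := by
      rw [hD]; exact mul_le_mul_of_nonneg_left hld (by positivity)
    have h6 : (d : ℝ) * Real.log A ≤ 2 * D * Real.log A := mul_le_mul_of_nonneg_right hdD hlA
    have h7 : -Real.log δ ≤ 2 * |Real.log δ| * D := by
      have := neg_abs_le (Real.log δ)
      nlinarith [abs_nonneg (Real.log δ)]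
    nlinarith
  · rw [div_mul_eq_mul_div, div_le_iff₀ hδ] at h3
    linarith

/-! ### Uniform curvature of the empirical risk -/

section Uniform

variable {d M : ℕ} {S Ω : Type*} [MeasurableSpace S] [MeasurableSpace Ω] {ν : Measure S}
  {P : Measure Ω} {W : Fin M → Ω → S} {Z : S → E d}

lemma HasMomentBounds.integral_sq_norm_le {τ ϖ : ℝ} (h : HasMomentBounds ν Z τ ϖ) :
    ∫ s, ‖Z s‖ ^ 2 ∂ν ≤ 8 * τ ^ 2 * d := by
  have he : ∀ s, ‖Z s‖ ^ 2 = ∑ j, (inner ℝ (EuclideanSpace.single j (1 : ℝ)) (Z s)) ^ 2 :=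
    fun s => by simp [norm_sq_eq_sum, EuclideanSpace.inner_single_left]
  simp only [he]
  rw [integral_finsetSum _ fun j _ => integrable_inner_sq h.memLp _]
  refine (Finset.sum_le_sum fun j _ => h.sq_le (EuclideanSpace.single j (1 : ℝ))).trans_eq ?_
  simp [mul_comm]

variable [IsProbabilityMeasure ν]

lemma HasMomentBounds.integral_norm_le {τ ϖ : ℝ} (h : HasMomentBounds ν Z τ ϖ) (hd : 1 ≤ d) :
    ∫ s, ‖Z s‖ ∂ν ≤ (1 + 8 * τ ^ 2) * d := by
  have hd' : (1 : ℝ) ≤ d := by exact_mod_cast hd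
  have hi : Integrable (fun s => 1 + ‖Z s‖ ^ 2) ν :=
    (integrable_const _).add (h.memLp.integrable_norm_pow two_ne_zero)
  have h1 := integral_mono (h.memLp.integrable one_le_two).norm hi fun s => by
    change ‖Z s‖ ≤ 1 + ‖Z s‖ ^ 2
    nlinarith [sq_nonneg (‖Z s‖ - 1)]
  rw [integral_add (integrable_const _) (h.memLp.integrable_norm_pow two_ne_zero)] at h1
  have h2 := h.integral_sq_norm_le
  simp only [integral_const, probReal_univ, smul_eq_mul, mul_one] at h1
  linarith

lemma abs_integral_truncCurv_sub_le (hZ : Integrable Z ν) {K ε : ℝ} (hK : 0 ≤ K)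
    {θ θ' u φ φ' w : E d} (h1 : ‖θ - φ‖ ≤ ε) (h2 : ‖θ' - φ'‖ ≤ ε) (h3 : ‖u - w‖ ≤ ε) :
    |∫ s, truncCurv K θ θ' u (Z s) ∂ν - ∫ s, truncCurv K φ φ' w (Z s) ∂ν|
      ≤ (2 * K ^ 2 + 2 * K) * ε * ∫ s, ‖Z s‖ ∂ν := by
  rw [← integral_sub (integrable_truncCurv hZ.1 K θ θ' u) (integrable_truncCurv hZ.1 K φ φ' w),
    ← integral_const_mul]
  refine (abs_integral_le_integral_abs).trans (integral_mono
    ((integrable_truncCurv hZ.1 K θ θ' u).sub (integrable_truncCurv hZ.1 K φ φ' w)).abs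
    (hZ.norm.const_mul _) fun s => abs_truncCurv_sub_le hK h1 h2 h3 (Z s))

/-- Outside an event of small probability, the empirical truncated curvature is at least half the
uniform lower bound `κ` of its expectation, simultaneously for all segments in the ball and all
directions. Hoeffding's inequality is applied at the points of a net, and the Lipschitz bound
extends the estimate to the ball. -/
lemma measureReal_not_curvature_le [IsProbabilityMeasure P] (hd : 1 ≤ d) (hM : M ≠ 0)
    (hW : ∀ i, HasLaw (W i) ν P) (hind : iIndepFun W P) (hZm : Measurable Z)
    (hZ : Integrable Z ν) {r κ K D : ℝ} (hr : 0 < r) (hκ : 0 < κ) (hK : 0 < K) (hD : 0 < D)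
    (hmean : ∀ θ θ' u : E d, ‖θ‖ ≤ r → ‖θ'‖ ≤ r → ‖u‖ = 1 →
      κ ≤ ∫ s, truncCurv K θ θ' u (Z s) ∂ν)
    (hnorm : ∫ s, ‖Z s‖ ∂ν ≤ D * d) :
    P.real {ω | ¬ ∀ θ θ' u : E d, ‖θ‖ ≤ r → ‖θ'‖ ≤ r → ‖u‖ = 1 →
      κ / 2 ≤ ∫ i, truncCurv K θ θ' u (Z (W i ω)) ∂(uniformIndex M)} ≤
    P.real {ω | D * d ≤ ∫ i, ‖Z (W i ω)‖ ∂(uniformIndex M)} +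
      (((16 * (r + 1) * (2 * K ^ 2 + 2 * K) * D / κ + 3) * (d : ℝ) ^ 2) ^ d) ^ 3 *
        Real.exp (-(2 * (κ / 8) ^ 2 / (K ^ 2) ^ 2 * M)) := by
  have := isProbabilityMeasure_uniformIndex hM
  have hd' : (1 : ℝ) ≤ d := by exact_mod_cast hd
  -- the mesh makes a net approximation cost at most `κ / 8`
  set η : ℝ := κ / (8 * (2 * K ^ 2 + 2 * K) * D * (d : ℝ) ^ 2) with hη
  have hη0 : 0 < η := by positivity
  have hmesh : (2 * K ^ 2 + 2 * K) * (d * η) * (D * d) = κ / 8 := by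
    rw [hη]; field_simp
  obtain ⟨N, hcard, hN⟩ := exists_net d (R := r + 1) (by positivity) hη0
  have hcard' : (N.card : ℝ)
      ≤ ((16 * (r + 1) * (2 * K ^ 2 + 2 * K) * D / κ + 3) * (d : ℝ) ^ 2) ^ d := by
    refine hcard.trans (pow_le_pow_left₀ (by positivity) ?_ _)
    have h1 : 2 * (r + 1) / η = 16 * (r + 1) * (2 * K ^ 2 + 2 * K) * D / κ * (d : ℝ) ^ 2 := by
      rw [hη]; field_simp; ring
    rw [h1, add_mul]
    nlinarith
  set E₁ := {ω | D * d ≤ ∫ i, ‖Z (W i ω)‖ ∂(uniformIndex M)} with hE₁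
  set E₂ : E d × E d × E d → Set Ω := fun p =>
    {ω | ∫ i, truncCurv K p.1 p.2.1 p.2.2 (Z (W i ω)) ∂(uniformIndex M)
      ≤ ∫ s, truncCurv K p.1 p.2.1 p.2.2 (Z s) ∂ν - κ / 8} with hE₂
  have hsub : {ω | ¬ ∀ θ θ' u : E d, ‖θ‖ ≤ r → ‖θ'‖ ≤ r → ‖u‖ = 1 →
      κ / 2 ≤ ∫ i, truncCurv K θ θ' u (Z (W i ω)) ∂(uniformIndex M)} ⊆
      E₁ ∪ ⋃ p ∈ N ×ˢ N ×ˢ N, E₂ p := by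
    intro ω hω
    by_contra hcon
    rw [Set.mem_union, not_or] at hcon
    obtain ⟨h1, h2⟩ := hcon
    refine hω fun θ θ' u hθ hθ' hu => ?_
    obtain ⟨p, hp, hp1⟩ := hN θ (by linarith)
    obtain ⟨p', hp', hp1'⟩ := hN θ' (by linarith)
    obtain ⟨q, hq, hq1⟩ := hN u (by linarith)
    have h3 : ω ∉ E₂ (p, p', q) := fun h => h2 (Set.mem_biUnion (x := (p, p', q))
      (Finset.mem_coe.2 (Finset.mk_mem_product hp (Finset.mk_mem_product hp' hq))) h)
    simp only [hE₁, hE₂, Set.mem_ofPred_eq, not_le] at h1 h3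
    have h4 := abs_integral_truncCurv_sub_le (ν := uniformIndex M) (Z := fun i => Z (W i ω))
      Integrable.of_finite hK.le hp1 hp1' hq1
    have h5 := abs_integral_truncCurv_sub_le hZ hK.le hp1 hp1' hq1
    have hpos : 0 ≤ (2 * K ^ 2 + 2 * K) * (d * η) := by positivity
    have h6 := mul_le_mul_of_nonneg_left h1.le hpos
    have h7 := mul_le_mul_of_nonneg_left hnorm hpos
    rw [hmesh] at h6 h7
    have h8 := hmean θ θ' u hθ hθ' hu
    rw [abs_le] at h4 h5
    linarith
  refine (measureReal_mono hsub).trans ((measureReal_union_le _ _).trans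
    (add_le_add le_rfl ?_))
  refine (measureReal_biUnion_finset_le _ _).trans ?_
  have hE₂le : ∀ p ∈ N ×ˢ N ×ˢ N, P.real (E₂ p)
      ≤ Real.exp (-(2 * (κ / 8) ^ 2 / (K ^ 2) ^ 2 * M)) := fun p _ =>
    measureReal_average_le_of_bounded hM hW hind
      (f := fun s => truncCurv K p.1 p.2.1 p.2.2 (Z s))
      ((continuous_truncCurv K _ _ _).measurable.comp hZm) (by positivity)
      (fun s => truncCurv_nonneg _ _ _ _ _) (fun s => truncCurv_le _ _ _ _ _) (by positivity)
  refine (Finset.sum_le_sum hE₂le).trans ?_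
  rw [Finset.sum_const, nsmul_eq_mul, Finset.card_product, Finset.card_product]
  refine mul_le_mul_of_nonneg_right ?_ (Real.exp_pos _).le
  push_cast
  calc (N.card : ℝ) * (N.card * N.card) = (N.card : ℝ) ^ 3 := by ring
    _ ≤ _ := pow_le_pow_left₀ (Nat.cast_nonneg _) hcard' 3

end Uniform

/-! ### Conclusions for a fixed sample -/

/-- A lower bound on the truncated curvature gives strong convexity of the risk along segments. -/
lemma risk_strongConvex {d : ℕ} {S : Type*} [MeasurableSpace S] {ν : Measure S}
    [IsProbabilityMeasure ν] {Z : S → E d} (hZ : MemLp Z 2 ν) {κ K : ℝ} {θ θ' : E d}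
    (h : ∀ u : E d, ‖u‖ = 1 → κ ≤ ∫ s, truncCurv K θ θ' u (Z s) ∂ν) :
    risk ν Z θ + inner ℝ (riskGrad ν Z θ) (θ' - θ) + κ / 2 * ‖θ' - θ‖ ^ 2 ≤ risk ν Z θ' := by
  have h1 := mul_sq_norm_le_integral_segCurv hZ h (θ' - θ)
  have h2 := risk_lower hZ θ θ'
  linarith

section Sample

variable {d M : ℕ} (x : Fin M → E d) (y : Fin M → ℝ) (lam : ℝ)

/-- The gradient of the regularized empirical objective. -/
def empiricalGrad (θ : E d) : E d :=
  riskGrad (uniformIndex M) (fun i => y i • x i) θ + lam • regGrad θ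

/-- The gradient of the objective attached to one observation. -/
def sampleGrad (i : Fin M) (θ : E d) : E d :=
  logLossDeriv (inner ℝ θ (y i • x i)) • (y i • x i) + lam • regGrad θ

lemma hasGradientAt_regularizer (θ : E d) : HasGradientAt regularizer (regGrad θ) θ :=
  hasGradientAt_of_abs_sub_le (C := 1) fun θ' => by
    rw [one_mul]; exact abs_regularizer_sub_le θ θ'

lemma hasGradientAt_add_const_mul {F G : E d → ℝ} {f g θ : E d} (hF : HasGradientAt F f θ)
    (hG : HasGradientAt G g θ) (c : ℝ) :
    HasGradientAt (fun θ => F θ + c * G θ) (f + c • g) θ := by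
  rw [hasGradientAt_iff_hasFDerivAt, map_add, map_smul]
  exact hF.hasFDerivAt.add (hG.hasFDerivAt.const_mul c)

lemma empiricalObjective_eq (θ : E d) : empiricalObjective x y lam θ =
    risk (uniformIndex M) (fun i => y i • x i) θ + lam * regularizer θ := by
  unfold empiricalObjective risk
  rw [integral_uniformIndex]
  simp only [logisticLoss_eq, smul_eq_mul]

lemma hasGradientAt_empiricalObjective (hM : M ≠ 0) (θ : E d) :
    HasGradientAt (empiricalObjective x y lam) (empiricalGrad x y lam θ) θ := by
  have := isProbabilityMeasure_uniformIndex hM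
  rw [show empiricalObjective x y lam = _ from funext (empiricalObjective_eq x y lam)]
  exact hasGradientAt_add_const_mul (hasGradientAt_risk MemLp.of_discrete θ)
    (hasGradientAt_regularizer θ) lam

lemma gradient_sampleObjective (i : Fin M) (θ : E d) :
    gradient (sampleObjective x y lam i) θ = sampleGrad x y lam i θ := by
  refine HasGradientAt.gradient ?_
  have h := hasGradientAt_risk (ν := Measure.dirac i) (Z := fun i => y i • x i)
    MemLp.of_discrete θ
  have h1 : risk (Measure.dirac i) (fun i => y i • x i) = fun θ => logisticLoss θ (x i) (y i) := by
    ext θ; rw [risk, integral_dirac, logisticLoss_eq]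
  rw [h1, riskGrad, integral_dirac] at h
  exact hasGradientAt_add_const_mul h (hasGradientAt_regularizer θ) lam

lemma measurable_sampleGrad (i : Fin M) : Measurable (sampleGrad x y lam i) := by
  unfold sampleGrad
  exact (((continuous_logLossDeriv.comp (by fun_prop)).smul continuous_const).add
    (continuous_regGrad.const_smul lam)).measurable

/-- The sampled gradients are unbiased for the gradient of the empirical objective. -/
lemma inner_empiricalGrad (hM : M ≠ 0) (θ v : E d) :
    inner ℝ (empiricalGrad x y lam θ) v
      = (1 / (M : ℝ)) * ∑ i, inner ℝ (sampleGrad x y lam i θ) v := by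
  have hM' : (M : ℝ) ≠ 0 := by exact_mod_cast hM
  unfold empiricalGrad sampleGrad riskGrad
  rw [integral_uniformIndex]
  simp only [inner_add_left, Finset.sum_add_distrib, inner_smul_left, sum_inner,
    RCLike.conj_to_real, Finset.sum_const, Finset.card_univ, Fintype.card_fin, nsmul_eq_mul]
  field_simp

variable {x y lam} {r κ K : ℝ}

/-- The regularizer weakens the strong convexity of the empirical risk by at most `λ`. -/
lemma empiricalObjective_strongConvex (hM : M ≠ 0) (hlam : 0 ≤ lam) {θ θ' : E d}
    (h : ∀ u : E d, ‖u‖ = 1 →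
      2 * (κ + lam) ≤ ∫ i, truncCurv K θ θ' u (y i • x i) ∂(uniformIndex M)) :
    empiricalObjective x y lam θ + inner ℝ (empiricalGrad x y lam θ) (θ' - θ)
      + κ * ‖θ' - θ‖ ^ 2 ≤ empiricalObjective x y lam θ' := by
  have := isProbabilityMeasure_uniformIndex hM
  have h1 := risk_strongConvex (ν := uniformIndex M) (Z := fun i => y i • x i)
    MemLp.of_discrete h
  have h2 := mul_le_mul_of_nonneg_left (neg_le_of_abs_le (abs_regularizer_sub_le θ θ')) hlam
  rw [empiricalObjective_eq, empiricalObjective_eq, empiricalGrad, inner_add_left,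
    inner_smul_left, RCLike.conj_to_real]
  linarith

/-- On a sample whose empirical objective is strongly convex on the ball, projected stochastic
gradient descent converges almost surely to the stationary minimizer. -/
lemma ae_tendsto_projectedSGD (hM : M ≠ 0) (hr : 0 < r) (hκ : 0 < κ) (hlam : 0 ≤ lam)
    (hF : ∀ θ ∈ Metric.closedBall (0 : E d) r, ∀ θ' ∈ Metric.closedBall (0 : E d) r,
      empiricalObjective x y lam θ + inner ℝ (empiricalGrad x y lam θ) (θ' - θ)
        + κ * ‖θ' - θ‖ ^ 2 ≤ empiricalObjective x y lam θ')
    {θM : E d} (hθM : IsUniqueStationaryMinimizer (empiricalObjective x y lam)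
      (Metric.closedBall (0 : E d) r) θM)
    {γ : ℕ → ℝ} (θ₀ : E d) (hγ : ∀ n, 0 ≤ γ n)
    (hγ1 : Tendsto (fun N => ∑ n ∈ Finset.range N, γ n) atTop atTop)
    (hγ2 : Summable fun n => γ n ^ 2) {Ω : Type*} [MeasurableSpace Ω] {Q : Measure Ω}
    [IsProbabilityMeasure Q] {idx : ℕ → Ω → Fin M} (hidx : ∀ n, Measurable (idx n))
    (hind : iIndepFun idx Q) (hunif : ∀ n j, Q.real (idx n ⁻¹' {j}) = 1 / (M : ℝ)) :
    ∀ᵐ ω ∂Q, Tendsto (fun n => projectedSGD x y lam r γ (fun k => idx k ω) θ₀ n)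
      atTop (𝓝 θM) := by
  refine ae_tendsto_of_projected_step (T := fun n ω =>
    projectedSGD x y lam r γ (fun k => idx k ω) θ₀ n) (g := sampleGrad x y lam)
    (K := ∑ i, ‖y i • x i‖ + lam * (2 * r)) hidx hind hunif hr.le hκ
    (measurable_sampleGrad x y lam) (fun j v hv => ?_) (mem_closedBall_zero_iff.1 hθM.mem)
    (fun v hv => ?_) hγ hγ1 hγ2 (fun ω => rfl) (fun n ω => ?_)
  · refine (norm_add_le _ _).trans (add_le_add ?_ ?_)
    · rw [norm_smul]
      refine (mul_le_of_le_one_left (norm_nonneg _) (abs_logLossDeriv_le _)).trans ?_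
      exact Finset.single_le_sum (f := fun i => ‖y i • x i‖) (fun i _ => norm_nonneg _)
        (Finset.mem_univ j)
    · rw [norm_smul, Real.norm_of_nonneg hlam]
      exact mul_le_mul_of_nonneg_left ((norm_regGrad_le v).trans (by linarith)) hlam
  · have hv' := mem_closedBall_zero_iff.2 hv
    have h1 := hF v hv' θM hθM.mem
    have h2 : empiricalObjective x y lam θM ≤ empiricalObjective x y lam v := by
      by_cases h : v = θM
      · rw [h]
      · exact (hθM.unique_min v hv' h).le
    rw [← inner_empiricalGrad x y lam hM, ← neg_sub θM v, inner_neg_right, norm_neg]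
    linarith
  · simp only [projectedSGD, gradient_sampleObjective]

end Sample

end LogisticLandscape

end

open LogisticLandscape in
theorem proposition2 (τ ϖ r : ℝ) (hτ : 0 < τ) (hϖ : 0 < ϖ) (hr : 0 < r) :
    ∃ c : ℝ, 0 < c ∧ ∀ δ : ℝ, 0 < δ → ∃ C : ℝ, 0 < C ∧
      ∀ (d M : ℕ) (lam : ℝ) (μ : Measure (E d)) (θopt : E d),
        1 ≤ d → 2 ≤ M → C * (d : ℝ) * Real.log (M : ℝ) ≤ (M : ℝ) →
        0 ≤ lam → lam * Real.sqrt (d : ℝ) ≤ c →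
        IsProbabilityMeasure μ → ∫ z, z ∂μ = 0 →
        IsSubGaussianLaw μ τ → SecondMomentGE μ (ϖ * τ ^ 2) →
        ‖θopt‖ ≤ r / 2 →
        IsUniqueStationaryMinimizer (populationRisk μ θopt)
          (Metric.closedBall (0 : E d) r) θopt ∧
        ∀ (Ω : Type*) [MeasurableSpace Ω] (P : Measure Ω) [IsProbabilityMeasure P]
          (x : Fin M → Ω → E d) (y : Fin M → Ω → ℝ),
          (∀ i, HasLaw (fun ω => (x i ω, y i ω)) (dataLaw μ θopt) P) →
          iIndepFun (fun i ω => (x i ω, y i ω)) P →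
          ∃ A : Set Ω, MeasurableSet A ∧ 1 - δ ≤ P.real A ∧
            ∀ ω ∈ A, ∃ θM : E d,
              IsUniqueStationaryMinimizer
                (empiricalObjective (fun i => x i ω) (fun i => y i ω) lam)
                (Metric.closedBall (0 : E d) r) θM ∧
              ∀ (γ : ℕ → ℝ) (θ₀ : E d), (∀ n, 0 ≤ γ n) →
                Tendsto (fun N => ∑ n ∈ Finset.range N, γ n) atTop atTop →
                Summable (fun n => γ n ^ 2) →
                ∀ (Ω' : Type*) [MeasurableSpace Ω'] (Q : Measure Ω') [IsProbabilityMeasure Q]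
                  (idx : ℕ → Ω' → Fin M),
                  (∀ n, Measurable (idx n)) → iIndepFun idx Q →
                  (∀ n j, Q.real (idx n ⁻¹' {j}) = 1 / (M : ℝ)) →
                  ∀ᵐ ω' ∂Q, Tendsto
                    (fun n => projectedSGD (fun i => x i ω) (fun i => y i ω) lam r γ
                      (fun k => idx k ω') θ₀ n) atTop (𝓝 θM) := by
  -- truncation levels: `K` controls the fourth moment, and then `T` the argument of the curvature
  obtain ⟨K, hK, hKτ⟩ : ∃ K : ℝ, 0 < K ∧ 192 * τ ^ 4 ≤ ϖ * τ ^ 2 * K ^ 2 := by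
    refine ⟨1 + 192 * τ ^ 2 / ϖ, by positivity, ?_⟩
    have h1 : 0 ≤ 192 * τ ^ 2 / ϖ := by positivity
    have h2 : 192 * τ ^ 2 / ϖ ≤ (1 + 192 * τ ^ 2 / ϖ) ^ 2 := by nlinarith
    calc 192 * τ ^ 4 = ϖ * τ ^ 2 * (192 * τ ^ 2 / ϖ) := by field_simp
      _ ≤ _ := mul_le_mul_of_nonneg_left h2 (by positivity)
  obtain ⟨T, hT, hTK⟩ : ∃ T : ℝ, 0 < T ∧
      64 * K ^ 2 * τ ^ 2 * r ^ 2 ≤ ϖ * τ ^ 2 * T ^ 2 := by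
    refine ⟨1 + 64 * K ^ 2 * r ^ 2 / ϖ, by positivity, ?_⟩
    have h1 : 0 ≤ 64 * K ^ 2 * r ^ 2 / ϖ := by positivity
    have h2 : 64 * K ^ 2 * r ^ 2 / ϖ ≤ (1 + 64 * K ^ 2 * r ^ 2 / ϖ) ^ 2 := by nlinarith
    calc 64 * K ^ 2 * τ ^ 2 * r ^ 2 = ϖ * τ ^ 2 * (64 * K ^ 2 * r ^ 2 / ϖ) := by field_simp
      _ ≤ _ := mul_le_mul_of_nonneg_left h2 (by positivity)
  set κ : ℝ := logLossCurv T * (ϖ * τ ^ 2 / 4) with hκdef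
  have hκ : 0 < κ := mul_pos (logLossCurv_pos T) (by positivity)
  -- half of `κ` survives sampling and enters the second-order expansion as `κ / 4`; taking
  -- `λ ≤ κ / 64` leaves strong convexity with constant `κ / 8`, and the regularizer then adds at
  -- most `κ r / 64` to the gradient at the true parameter
  refine ⟨κ / 64, by positivity, fun δ hδ => ?_⟩
  -- by Markov's inequality the average of `‖Z‖` exceeds `D d` with probability at most `δ / 3`
  set D : ℝ := (1 + 8 * τ ^ 2) * (1 + 3 / δ) with hD
  have hD0 : 0 < D := by positivity
  -- the first entry of the minimum serves the union bound over the net, the second one Chebyshev's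
  -- inequality for the gradient at the true parameter
  obtain ⟨C, hC, hCM⟩ := exists_sampleSize_const
    (A := 16 * (r + 1) * (2 * K ^ 2 + 2 * K) * D / κ + 3)
    (c := 2 * (κ / 8) ^ 2 / (K ^ 2) ^ 2) (δ := min (δ / 3) (δ * (κ * r / 64) ^ 2 / (24 * τ ^ 2)))
    (by have : 0 ≤ 16 * (r + 1) * (2 * K ^ 2 + 2 * K) * D / κ := by positivity
        linarith) (by positivity) (by positivity)
  refine ⟨C, hC, fun d M lam μ θopt hd hM hsize hlam hlamc hμ hμ0 hsub hsm hθopt => ?_⟩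
  obtain ⟨hnet, hdM⟩ := hCM d M hd hM hsize
  have hM0 : M ≠ 0 := by omega
  have hM' : (0 : ℝ) < M := by exact_mod_cast Nat.pos_of_ne_zero hM0
  have hd' : (1 : ℝ) ≤ d := by exact_mod_cast hd
  have hmom := hasMomentBounds_signedCovariate hτ hsub hμ0 hsm θopt
  have hmean : ∀ θ θ' u : E d, ‖θ‖ ≤ r → ‖θ'‖ ≤ r → ‖u‖ = 1 →
      κ ≤ ∫ s, truncCurv K θ θ' u (signedCovariate s) ∂(dataLaw μ θopt) :=
    fun θ θ' u hθ hθ' hu => hmom.truncCurv_ge hK hT hKτ hTK hθ hθ' hu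
  have hgrad0 := riskGrad_dataLaw_eq_zero hmom.memLp
  refine ⟨?_, fun Ω _ P _ x y hlaw hind => ?_⟩
  · rw [populationRisk_eq]
    refine isUniqueStationaryMinimizer_of_strongConvex (κ := κ / 2) (by positivity)
      (fun θ hθ θ' hθ' => ?_) (hasGradientAt_risk hmom.memLp) ?_ hgrad0
    · rw [mem_closedBall_zero_iff] at hθ hθ'
      exact risk_strongConvex hmom.memLp fun u hu => hmean θ θ' u hθ hθ' hu
    · rw [mem_closedBall_zero_iff]; linarith
  -- the exceptional events
  set B₁ : Set Ω := {ω | ¬ ∀ θ θ' u : E d, ‖θ‖ ≤ r → ‖θ'‖ ≤ r → ‖u‖ = 1 →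
    κ / 2 ≤ ∫ i, truncCurv K θ θ' u (signedCovariate (x i ω, y i ω)) ∂(uniformIndex M)} with hB₁
  set B₂ : Set Ω := {ω | κ * r / 64 ≤ ‖∫ i, logLossDeriv (inner ℝ θopt
    (signedCovariate (x i ω, y i ω))) • signedCovariate (x i ω, y i ω) ∂(uniformIndex M)‖} with hB₂
  have hp1 : P.real B₁ ≤ δ / 3 + δ / 3 := by
    refine (measureReal_not_curvature_le hd hM0 hlaw hind measurable_signedCovariate
      (hmom.memLp.integrable one_le_two) hr hκ hK hD0 hmean ?_).trans (add_le_add ?_ ?_)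
    · refine (hmom.integral_norm_le hd).trans (mul_le_mul_of_nonneg_right ?_ (by positivity))
      exact le_mul_of_one_le_right (by positivity) (le_add_of_nonneg_right (by positivity))
    · refine (measureReal_average_ge_le hM0 hlaw (f := fun s => ‖signedCovariate s‖)
        (hmom.memLp.integrable one_le_two).norm (fun s => norm_nonneg _) (by positivity)).trans ?_
      rw [div_le_iff₀ (by positivity)]
      refine (hmom.integral_norm_le hd).trans ?_
      have h1 : δ / 3 * (D * d) = (1 + 8 * τ ^ 2) * d * (δ / 3 + 1) := by
        rw [hD]; field_simp
      rw [h1]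
      exact le_mul_of_one_le_right (by positivity) (by linarith)
    · exact hnet.trans (min_le_left _ _)
  have hp2 : P.real B₂ ≤ δ / 3 := by
    have hgm : Measurable fun s : E d × ℝ =>
        logLossDeriv (inner ℝ θopt (signedCovariate s)) • signedCovariate s :=
      (continuous_logLossDeriv.measurable.comp
        (measurable_signedCovariate.const_inner (c := θopt))).smul measurable_signedCovariate
    have hgn : ∀ s : E d × ℝ, ‖logLossDeriv (inner ℝ θopt (signedCovariate s)) • signedCovariate s‖
        ≤ ‖signedCovariate s‖ := fun s => by
      rw [norm_smul]
      exact mul_le_of_le_one_left (norm_nonneg _) (abs_logLossDeriv_le _)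
    have hg2 := hmom.memLp.mono hgm.aestronglyMeasurable (ae_of_all _ hgn)
    refine (measureReal_norm_average_ge_le hM0 hlaw hind hgm hg2 hgrad0
      (by positivity)).trans ?_
    rw [div_le_iff₀ (by positivity)]
    have h1 := integral_mono (hg2.integrable_norm_pow two_ne_zero)
      (hmom.memLp.integrable_norm_pow two_ne_zero)
      fun s => pow_le_pow_left₀ (norm_nonneg _) (hgn s) 2
    refine h1.trans (hmom.integral_sq_norm_le.trans ?_)
    have h2 : (d : ℝ) ≤ δ * (κ * r / 64) ^ 2 / (24 * τ ^ 2) * M :=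
      hdM.trans (mul_le_mul_of_nonneg_right (min_le_right _ _) hM'.le)
    calc 8 * τ ^ 2 * d ≤ 8 * τ ^ 2 * (δ * (κ * r / 64) ^ 2 / (24 * τ ^ 2) * M) :=
          mul_le_mul_of_nonneg_left h2 (by positivity)
      _ = δ / 3 * (M * (κ * r / 64) ^ 2) := by field_simp; ring
  -- the exceptional set need not be measurable, so it is enlarged to its measurable hull
  refine ⟨(toMeasurable P (B₁ ∪ B₂))ᶜ, (measurableSet_toMeasurable _ _).compl, ?_, fun ω hω => ?_⟩
  · rw [probReal_compl_eq_one_sub (measurableSet_toMeasurable _ _), measureReal_def,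
      measure_toMeasurable, ← measureReal_def]
    have := measureReal_union_le (μ := P) B₁ B₂
    linarith
  have hnot : ω ∉ B₁ ∪ B₂ := fun h => hω (subset_toMeasurable P _ h)
  rw [Set.mem_union, not_or] at hnot
  have hcurv := not_not.1 hnot.1
  have hgrad := hnot.2
  simp only [hB₂, Set.mem_ofPred_eq, not_le] at hgrad
  have hlamκ : lam ≤ κ / 64 := by
    have : 1 ≤ Real.sqrt d := Real.one_le_sqrt.2 hd'
    nlinarith
  have hF : ∀ θ ∈ Metric.closedBall (0 : E d) r, ∀ θ' ∈ Metric.closedBall (0 : E d) r,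
      empiricalObjective (fun i => x i ω) (fun i => y i ω) lam θ
        + inner ℝ (empiricalGrad (fun i => x i ω) (fun i => y i ω) lam θ) (θ' - θ)
        + κ / 8 * ‖θ' - θ‖ ^ 2
        ≤ empiricalObjective (fun i => x i ω) (fun i => y i ω) lam θ' := by
    intro θ hθ θ' hθ'
    rw [mem_closedBall_zero_iff] at hθ hθ'
    refine empiricalObjective_strongConvex (K := K) hM0 hlam fun u hu => ?_
    exact le_trans (by linarith) (hcurv θ θ' u hθ hθ' hu)
  obtain ⟨θM, hθM, -⟩ := exists_isUniqueStationaryMinimizer hr (by positivity : 0 < κ / 8) hF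
    (hasGradientAt_empiricalObjective _ _ lam hM0) hθopt (by
      refine (norm_add_le _ _).trans_lt ?_
      have h1 : ‖lam • regGrad θopt‖ ≤ κ / 64 * r := by
        rw [norm_smul, Real.norm_of_nonneg hlam]
        exact mul_le_mul hlamκ ((norm_regGrad_le θopt).trans (by linarith)) (norm_nonneg _)
          (by positivity)
      refine (add_lt_add_of_lt_of_le hgrad h1).trans_le ?_
      nlinarith)
  exact ⟨θM, hθM, fun γ θ₀ hγ hγ1 hγ2 Ω' _ Q _ idx hidx hidxind hunif =>
    ae_tendsto_projectedSGD hM0 hr (by positivity) hlam hF hθM θ₀ hγ hγ1 hγ2 hidx hidxind hunif⟩
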